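/- Let $M\ge 1$, let $x_1<x_2<\cdots<x_M$ and $y_1,\dots,y_M$ be real numbers, let $\lambda>0$, and let $E:\mathbb{R}\times\mathbb{R}\to\mathbb{R}$ be such that, for every $v\in\mathbb{R}$, the function $E(\cdot,v)$ is strictly convex and coercive ($E(u,v)\to+\infty$ as $|u|\to\infty$). Let ${\rm Lip}(\mathbb{R})$ be the space of Lipschitz functions $f:\mathbb{R}\to\mathbb{R}$, with Lipschitz constant $L(f)=\sup_{s\neq t}|f(s)-f(t)|/|s-t|$. It is the dual of ${\rm D}(L_1(\mathbb{R}))\oplus{\rm span}({\rm e}^{-(\cdot)^2})$ through $\langle f,{\rm D}g+c\,{\rm e}^{-(\cdot)^2}\rangle=-\int f'g+c\int f(t){\rm e}^{-t^2}{\rm d}t$, and carries the corresponding weak* topology. Let $$\mathcal V_{\rm Lip}=\operatorname*{arg\,min}_{f\in{\rm Lip}(\mathbb{R})}\Big(\sum_{m=1}^M E(f(x_m),y_m)+\lambda L(f)\Big).$$ 1. $\mathcal V_{\rm Lip}$ is a nonempty, convex and weak*-compact subset of ${\rm Lip}(\mathbb{R})$. 2. There is a unique vector ${\bf z}=(z_m)\in\mathbb{R}^M$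 such that $\mathcal V_{\rm Lip}$ is the set of minimizers of $L(f)$ over the $f\in{\rm Lip}(\mathbb{R})$ with $f(x_m)=z_m$ for all $m$. For this ${\bf z}$, moreover: 3. Every $f\in\mathcal V_{\rm Lip}$ satisfies $L(f)=L_{\min}$, where $L_{\min}=\max_{2\le m\le M}\left|\frac{z_m-z_{m-1}}{x_m-x_{m-1}}\right|$ (and $L_{\min}=0$ if $M=1$). Every $L_{\min}$-Lipschitz function $f$ with $f(x_m)=z_m$ for all $m$ belongs to $\mathcal V_{\rm Lip}$. 4. Let $\mathcal R=\{\alpha_1(1,L_{\min})+\alpha_2(1,-L_{\min}):\alpha_1,\alpha_2\ge 0\}$, $\mathcal L=-\mathcal R$, $\mathcal R_m=(x_m,z_m)+\mathcal R$ and $\mathcal L_m=(x_m,z_m)+\mathcal L$ for $1\le m\le M$, and $\mathcal R_0=\mathcal L_{M+1}=\mathbb{R}^2$. Then $$\{(x,y)\in\mathbb{R}^2:\exists f\in\mathcal V_{\rm Lip},\ y=f(x)\}=\bigcup_{m=1}^{M+1}\left(\mathcal R_{m-1}\cap\mathcal L_m\right).$$ 5. Let ${\rm TV}^{(2)}(f)=\sup\int_{\mathbb{R}}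 f\varphi''$, the supremum being over the smooth compactly supported $\varphi$ with $\|\varphi\|_\infty\le 1$, and let ${\rm BV}^{(2)}(\mathbb{R})$ be the space of continuous $f:\mathbb{R}\to\mathbb{R}$ with ${\rm TV}^{(2)}(f)<\infty$. If $M\ge 2$, then every minimizer of ${\rm TV}^{(2)}(f)$ over the $f\in{\rm BV}^{(2)}(\mathbb{R})$ with $f(x_m)=z_m$ for all $m$ belongs to $\mathcal V_{\rm Lip}$. Moreover (for every $M\ge1$), some continuous function that is piecewise linear with finitely many pieces is such a minimizer and belongs to $\mathcal V_{\rm Lip}$. -/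

import Mathlib

open Set Filter Topology MeasureTheory
open scoped Pointwise ContDiff NNReal ENNReal

/-- The space `Lip(ℝ)` of Lipschitz-continuous functions `ℝ → ℝ`. -/
def LipR : Submodule ℝ (ℝ → ℝ) where
  carrier := {f | ∃ K : ℝ≥0, LipschitzWith K f}
  add_mem' := by
    rintro f g ⟨K, hf⟩ ⟨K', hg⟩
    exact ⟨K + K', hf.add hg⟩
  zero_mem' := ⟨0, LipschitzWith.const 0⟩
  smul_mem' := by
    rintro c f ⟨K, hf⟩
    exact ⟨‖c‖₊ * K, (lipschitzWith_smul c).comp hf⟩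

/-- The Lipschitz constant `L(f) = sup_{s ≠ t} |f s - f t| / |s - t|`
(a finite supremum for `f ∈ Lip(ℝ)`). -/
noncomputable def lipConst (f : ℝ → ℝ) : ℝ :=
  ⨆ p : {p : ℝ × ℝ // p.1 ≠ p.2}, |f p.1.1 - f p.1.2| / |p.1.1 - p.1.2|

/-! ### The weak* topology of `Lip(ℝ)` -/

/-- The derivative of a Lipschitz function may be integrated against an `L¹` function. -/
theorem LipR.integrable_deriv_mul (f : LipR) (g : Lp ℝ 1 (volume : Measure ℝ)) :
    Integrable (fun t => deriv (f : ℝ → ℝ) t * g t) := by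
  obtain ⟨K, hK⟩ := f.2
  exact (L1.integrable_coeFn g).bdd_mul (measurable_deriv _).aestronglyMeasurable
    (Eventually.of_forall fun t => norm_deriv_le_of_lipschitz hK)

/-- A Lipschitz function may be integrated against the Gaussian. -/
theorem LipR.integrable_mul_gauss (f : LipR) :
    Integrable (fun t => (f : ℝ → ℝ) t * Real.exp (-t ^ 2)) := by
  obtain ⟨K, hK⟩ := f.2
  have h0 : Integrable (fun t : ℝ => Real.exp (-t ^ 2)) := by
    simpa using integrable_exp_neg_mul_sq (b := 1) one_pos
  have h1 : Integrable (fun t : ℝ => t * Real.exp (-t ^ 2)) := by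
    simpa using integrable_mul_exp_neg_mul_sq (b := 1) one_pos
  refine ((h0.const_mul |(f : ℝ → ℝ) 0|).add (h1.abs.const_mul (K : ℝ))).mono' ?_ ?_
  · exact (hK.continuous.mul (by fun_prop)).aestronglyMeasurable
  · refine Eventually.of_forall fun t => ?_
    have h2 : |(f : ℝ → ℝ) t - (f : ℝ → ℝ) 0| ≤ K * |t| := by
      simpa [Real.dist_eq] using hK.dist_le_mul t 0
    have h3 : |(f : ℝ → ℝ) t| ≤ |(f : ℝ → ℝ) 0| + K * |t| := by
      have := abs_add_le ((f : ℝ → ℝ) t - (f : ℝ → ℝ) 0) ((f : ℝ → ℝ) 0)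
      rw [sub_add_cancel] at this
      linarith
    have h4 := Real.exp_pos (-t ^ 2)
    simp only [Pi.add_apply, Real.norm_eq_abs, abs_mul, abs_of_pos h4]
    nlinarith

/-- The duality pairing between `Lip(ℝ)` and its predual
`D(L¹(ℝ)) ⊕ span(exp(-(·)²))`. The element `D g + c exp(-(·)²)` of the predual, with `g ∈ L¹(ℝ)`
and `c ∈ ℝ`, is represented by the pair `(g, c)` that determines it, and
`⟨f, D g + c exp(-(·)²)⟩ = -∫ f' g + c ∫ f(t) exp(-t²) dt`. -/
noncomputable def lipPairing :
    LipR →ₗ[ℝ] (Lp ℝ 1 (volume : Measure ℝ) × ℝ) →ₗ[ℝ] ℝ :=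
  LinearMap.mk₂ ℝ
    (fun f w => -(∫ t, deriv (f : ℝ → ℝ) t * w.1 t)
      + w.2 * ∫ t, (f : ℝ → ℝ) t * Real.exp (-t ^ 2))
    (by
      intro f₁ f₂ w
      have hd : (fun t => deriv ((f₁ + f₂ : LipR) : ℝ → ℝ) t * w.1 t) =ᵐ[volume]
          fun t => deriv (f₁ : ℝ → ℝ) t * w.1 t + deriv (f₂ : ℝ → ℝ) t * w.1 t := by
        obtain ⟨K₁, h₁⟩ := f₁.2
        obtain ⟨K₂, h₂⟩ := f₂.2
        filter_upwards [h₁.ae_differentiableAt, h₂.ae_differentiableAt] with t a b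
        rw [Submodule.coe_add, deriv_add a b, add_mul]
      have hg : (fun t => ((f₁ + f₂ : LipR) : ℝ → ℝ) t * Real.exp (-t ^ 2)) =
          fun t => (f₁ : ℝ → ℝ) t * Real.exp (-t ^ 2) + (f₂ : ℝ → ℝ) t * Real.exp (-t ^ 2) := by
        funext t
        rw [Submodule.coe_add, Pi.add_apply, add_mul]
      rw [integral_congr_ae hd, hg,
        integral_add (LipR.integrable_deriv_mul f₁ w.1) (LipR.integrable_deriv_mul f₂ w.1),
        integral_add (LipR.integrable_mul_gauss f₁) (LipR.integrable_mul_gauss f₂)]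
      ring)
    (by
      intro c f w
      have hd : (fun t => deriv ((c • f : LipR) : ℝ → ℝ) t * w.1 t) =ᵐ[volume]
          fun t => c * (deriv (f : ℝ → ℝ) t * w.1 t) := by
        obtain ⟨K, h⟩ := f.2
        filter_upwards [h.ae_differentiableAt] with t a
        rw [Submodule.coe_smul, deriv_const_smul c a, smul_eq_mul, mul_assoc]
      have hg : (fun t => ((c • f : LipR) : ℝ → ℝ) t * Real.exp (-t ^ 2)) =
          fun t => c * ((f : ℝ → ℝ) t * Real.exp (-t ^ 2)) := by
        funext t
        rw [Submodule.coe_smul, Pi.smul_apply, smul_eq_mul, mul_assoc]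
      rw [integral_congr_ae hd, hg, integral_const_mul, integral_const_mul, smul_eq_mul]
      ring)
    (by
      intro f w₁ w₂
      have hd : (fun t => deriv (f : ℝ → ℝ) t * (w₁ + w₂).1 t) =ᵐ[volume]
          fun t => deriv (f : ℝ → ℝ) t * w₁.1 t + deriv (f : ℝ → ℝ) t * w₂.1 t := by
        filter_upwards [Lp.coeFn_add w₁.1 w₂.1] with t a
        rw [Prod.fst_add, a, Pi.add_apply, mul_add]
      rw [integral_congr_ae hd,
        integral_add (LipR.integrable_deriv_mul f w₁.1) (LipR.integrable_deriv_mul f w₂.1),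
        Prod.snd_add]
      ring)
    (by
      intro c f w
      have hd : (fun t => deriv (f : ℝ → ℝ) t * (c • w).1 t) =ᵐ[volume]
          fun t => c * (deriv (f : ℝ → ℝ) t * w.1 t) := by
        filter_upwards [Lp.coeFn_smul c w.1] with t a
        rw [Prod.smul_fst, a, Pi.smul_apply, smul_eq_mul]
        ring
      rw [integral_congr_ae hd, integral_const_mul, Prod.smul_snd, smul_eq_mul, smul_eq_mul]
      ring)

/-- The weak* topology of `Lip(ℝ)`: the coarsest topology for which all the functionals
`f ↦ ⟨f, w⟩`, with `w` in the predual, are continuous. -/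
noncomputable abbrev lipWeakStar : TopologicalSpace LipR :=
  TopologicalSpace.induced (fun f w => lipPairing f w) Pi.topologicalSpace

/-- Compactness of a subset of `Lip(ℝ)` in the weak* topology. -/
def IsWeakStarCompact (S : Set LipR) : Prop :=
  @IsCompact LipR lipWeakStar S

/-! ### The minimization problems -/

/-- The cost `∑ₘ E(f(xₘ), yₘ) + lam * L(f)`. -/
noncomputable def lipCost {M : ℕ} (E : ℝ → ℝ → ℝ) (lam : ℝ) (x y : Fin M → ℝ) (f : LipR) : ℝ :=
  ∑ m, E ((f : ℝ → ℝ) (x m)) (y m) + lam * lipConst (f : ℝ → ℝ)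

/-- The solution set of the Lipschitz-regularized problem over `Lip(ℝ)`. -/
def lipSolutions {M : ℕ} (E : ℝ → ℝ → ℝ) (lam : ℝ) (x y : Fin M → ℝ) : Set LipR :=
  {f | ∀ g : LipR, lipCost E lam x y f ≤ lipCost E lam x y g}

/-- `f` interpolates the points `(xₘ, zₘ)`. -/
def Interpolates {M : ℕ} (x z : Fin M → ℝ) (f : ℝ → ℝ) : Prop :=
  ∀ m, f (x m) = z m

/-- The solution set of: minimize `L(f)` over `f ∈ Lip(ℝ)` such that `f(xₘ) = zₘ` for all `m`. -/
def lipInterpSolutions {M : ℕ} (x z : Fin M → ℝ) : Set LipR :=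
  {f | Interpolates x z f ∧ ∀ g : LipR, Interpolates x z g → lipConst f ≤ lipConst g}

/-- The largest modulus of a slope between consecutive points, for `M = n + 1` points
(`0` if there is only one point). -/
noncomputable def maxSlope {n : ℕ} (x z : Fin (n + 1) → ℝ) : ℝ :=
  ⨆ i : Fin n, |(z i.succ - z i.castSucc) / (x i.succ - x i.castSucc)|

/-- The union of the graphs of the functions in `V`. -/
def unionGraph (V : Set LipR) : Set (ℝ × ℝ) :=
  {p | ∃ f ∈ V, p.2 = (f : ℝ → ℝ) p.1}

/-- The right planar cone of slope `L`. -/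
def rightCone (L : ℝ) : Set (ℝ × ℝ) :=
  {p | ∃ a b : ℝ, 0 ≤ a ∧ 0 ≤ b ∧ p = a • ((1, L) : ℝ × ℝ) + b • ((1, -L) : ℝ × ℝ)}

/-- The left planar cone of slope `L`. -/
def leftCone (L : ℝ) : Set (ℝ × ℝ) :=
  -rightCone L

/-- The right cone with apex at the `m`-th point, where points are counted from `1` to `M`;
the whole plane for `m = 0` (and, by default, for `m > M`, which is not used). -/
def rightConeAt {M : ℕ} (x z : Fin M → ℝ) (L : ℝ) (m : ℕ) : Set (ℝ × ℝ) :=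
  if h : 1 ≤ m ∧ m ≤ M then
    ((x ⟨m - 1, by omega⟩, z ⟨m - 1, by omega⟩) : ℝ × ℝ) +ᵥ rightCone L
  else univ

/-- The left cone with apex at the `m`-th point, where points are counted from `1` to `M`;
the whole plane for `m = M + 1` (and, by default, for other `m` out of range, which are not
used). -/
def leftConeAt {M : ℕ} (x z : Fin M → ℝ) (L : ℝ) (m : ℕ) : Set (ℝ × ℝ) :=
  if h : 1 ≤ m ∧ m ≤ M then
    ((x ⟨m - 1, by omega⟩, z ⟨m - 1, by omega⟩) : ℝ × ℝ) +ᵥ leftCone L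
  else univ

/-! ### Second-order total variation and piecewise-linear functions -/

/-- The second-order total variation `TV⁽²⁾(f) = ‖D² f‖_M`: the supremum of
`⟨D² f, φ⟩ = ∫ f φ''` over the smooth compactly supported `φ` with `|φ| ≤ 1`. -/
noncomputable def TV2 (f : ℝ → ℝ) : ℝ≥0∞ :=
  ⨆ (φ : ℝ → ℝ) (_ : ContDiff ℝ ∞ φ) (_ : HasCompactSupport φ) (_ : ∀ t, |φ t| ≤ 1),
    ENNReal.ofReal (∫ t, f t * deriv (deriv φ) t)

/-- The space `BV⁽²⁾(ℝ)` of functions of finite second-order total variation. Every distribution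
whose second derivative is a bounded measure is a continuous function; as the point values
matter, the elements are taken to be the continuous representatives. -/
def BV2 : Set (ℝ → ℝ) :=
  {f | Continuous f ∧ TV2 f < ⊤}

/-- The solution set of: minimize `TV⁽²⁾(f)` over `f ∈ BV⁽²⁾(ℝ)` such that `f(xₘ) = zₘ` for
all `m`. -/
def tv2InterpSolutions {M : ℕ} (x z : Fin M → ℝ) : Set (ℝ → ℝ) :=
  {f | f ∈ BV2 ∧ Interpolates x z f ∧ ∀ g ∈ BV2, Interpolates x z g → TV2 f ≤ TV2 g}

/-- Continuous and piecewise linear: `f` is continuous and, for some finite set `T` of knots,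
affine on every interval (bounded or not) that contains no knot. -/
def IsCPWL (f : ℝ → ℝ) : Prop :=
  Continuous f ∧ ∃ T : Finset ℝ, ∀ I : Set ℝ, I.OrdConnected → Disjoint I (T : Set ℝ) →
    ∃ a b : ℝ, ∀ t ∈ I, f t = a * t + b

/-!
For fixed values `z` at the data points, the smallest Lipschitz constant of an interpolant is
`maxSlope x z`, because chords between consecutive points control all chords and Lipschitz
functions extend from any set without increasing the constant. The problem therefore reduces to
minimizing the strictly convex coercive function `∑ E(zₘ, yₘ) + lam * maxSlope x z` of `z ∈ ℝᴹ`;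
for its unique minimizer `z`, the solutions are the `maxSlope x z`-Lipschitz interpolants of `z`.
Weak* compactness comes from the Arzelà–Ascoli theorem, since on a set of functions with a common
Lipschitz constant compact convergence implies weak* convergence.

For the second-order total variation, the supremum of the variations of the chord slopes of `f`
over finite samplings is a lower bound for `TV⁽²⁾(f)`, as testing against mollified combinations of
hat functions shows, and the linear spline through a sampling attains the variation for it. So if
`f` is a minimal interpolant, inserting a further point into the sampling cannot increase the
variation of its chord slopes. Then the slopes next to the inserted point do not exceed the largest
slope already present, and the same holds for `-f`; hence all chord slopes of `f` are bounded by
`maxSlope x z`.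
-/

section LipschitzConstant

variable {f : ℝ → ℝ} {K : ℝ}

theorem abs_sub_le_lipConst_mul (hf : f ∈ LipR) (s t : ℝ) :
    |f s - f t| ≤ lipConst f * |s - t| := by
  rcases eq_or_ne s t with rfl | hst
  · simp
  obtain ⟨K, hK⟩ := hf
  have hbdd : BddAbove (range fun p : {p : ℝ × ℝ // p.1 ≠ p.2} =>
      |f p.1.1 - f p.1.2| / |p.1.1 - p.1.2|) := by
    refine ⟨K, forall_mem_range.2 fun p => ?_⟩
    rw [div_le_iff₀ (abs_pos.2 (sub_ne_zero.2 p.2))]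
    exact hK.dist_le_mul p.1.1 p.1.2
  exact (div_le_iff₀ (abs_pos.2 (sub_ne_zero.2 hst))).1 (le_ciSup hbdd ⟨(s, t), hst⟩)

theorem nonneg_of_abs_sub_le (h : ∀ s t, |f s - f t| ≤ K * |s - t|) : 0 ≤ K := by
  simpa using (abs_nonneg _).trans (h 1 0)

theorem lipConst_le (h : ∀ s t, |f s - f t| ≤ K * |s - t|) : lipConst f ≤ K :=
  Real.iSup_le (fun p => (div_le_iff₀ (abs_pos.2 (sub_ne_zero.2 p.2))).2 (h _ _))
    (nonneg_of_abs_sub_le h)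

theorem lipschitzWith_toNNReal_iff (hK : 0 ≤ K) :
    LipschitzWith K.toNNReal f ↔ ∀ s t, |f s - f t| ≤ K * |s - t| := by
  simp only [lipschitzWith_iff_dist_le_mul, Real.dist_eq, Real.coe_toNNReal K hK]

theorem mem_LipR_of_abs_sub_le (h : ∀ s t, |f s - f t| ≤ K * |s - t|) : f ∈ LipR :=
  ⟨_, (lipschitzWith_toNNReal_iff (nonneg_of_abs_sub_le h)).2 h⟩

theorem exists_lipschitz_interpolation {ι : Type*} {X Z : ι → ℝ} (hK : 0 ≤ K)
    (h : ∀ i j, |Z i - Z j| ≤ K * |X i - X j|) :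
    ∃ f : ℝ → ℝ, (∀ s t, |f s - f t| ≤ K * |s - t|) ∧ ∀ i, f (X i) = Z i := by
  have hfac : Z.FactorsThrough X := fun i j hij => by
    have hZ := h i j
    rw [hij, sub_self, abs_zero, mul_zero] at hZ
    exact sub_eq_zero.1 (abs_nonpos_iff.1 hZ)
  have hlip : LipschitzOnWith K.toNNReal (Function.extend X Z 0) (range X) := by
    refine LipschitzOnWith.of_dist_le_mul (forall_mem_range.2 fun i => forall_mem_range.2
      fun j => ?_)
    simpa only [hfac.extend_apply, Real.dist_eq, Real.coe_toNNReal K hK] using h i j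
  obtain ⟨f, hf, hfX⟩ := hlip.extend_real
  exact ⟨f, (lipschitzWith_toNNReal_iff hK).1 hf, fun i => by
    rw [← hfX (mem_range_self i), hfac.extend_apply]⟩

end LipschitzConstant

section MaxSlope

variable {n : ℕ} {x z : Fin (n + 1) → ℝ} {f : ℝ → ℝ} {K : ℝ}

theorem maxSlope_nonneg (x z : Fin (n + 1) → ℝ) : 0 ≤ maxSlope x z :=
  Real.iSup_nonneg fun _ => abs_nonneg _

theorem abs_slope_le_maxSlope (x z : Fin (n + 1) → ℝ) (i : Fin n) :
    |(z i.succ - z i.castSucc) / (x i.succ - x i.castSucc)| ≤ maxSlope x z :=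
  le_ciSup (f := fun i : Fin n => |(z i.succ - z i.castSucc) / (x i.succ - x i.castSucc)|)
    (finite_range _).bddAbove i

theorem abs_sub_le_maxSlope_mul (hx : StrictMono x) (z : Fin (n + 1) → ℝ) (i j : Fin (n + 1)) :
    |z i - z j| ≤ maxSlope x z * |x i - x j| := by
  have hsucc : ∀ i : Fin n, |z i.succ - z i.castSucc| ≤
      maxSlope x z * (x i.succ - x i.castSucc) := fun i => by
    have hpos : 0 < x i.succ - x i.castSucc := sub_pos.2 (hx Fin.castSucc_lt_succ)
    rw [← div_le_iff₀ hpos]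
    simpa only [abs_div, abs_of_pos hpos] using abs_slope_le_maxSlope x z i
  have hanti : Antitone fun i => z i - maxSlope x z * x i :=
    Fin.antitone_iff_succ_le.2 fun i => by linarith [(abs_le.1 (hsucc i)).2]
  have hmono : Monotone fun i => z i + maxSlope x z * x i :=
    Fin.monotone_iff_le_succ.2 fun i => by linarith [(abs_le.1 (hsucc i)).1]
  wlog hij : i ≤ j generalizing i j with H
  · rw [abs_sub_comm, abs_sub_comm (x i)]
    exact H j i (le_of_not_ge hij)
  have hle : z i + maxSlope x z * x i ≤ z j + maxSlope x z * x j := hmono hij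
  have hge : z j - maxSlope x z * x j ≤ z i - maxSlope x z * x i := hanti hij
  rw [abs_of_nonpos (sub_nonpos.2 (hx.monotone hij)), abs_le]
  exact ⟨by linarith, by linarith⟩

theorem maxSlope_le_of_interpolates (hx : StrictMono x) (hf : Interpolates x z f)
    (h : ∀ s t, |f s - f t| ≤ K * |s - t|) : maxSlope x z ≤ K := by
  refine Real.iSup_le (fun i => ?_) (nonneg_of_abs_sub_le h)
  have hpos : 0 < |x i.succ - x i.castSucc| :=
    abs_pos.2 (sub_pos.2 (hx Fin.castSucc_lt_succ)).ne'
  rw [abs_div, div_le_iff₀ hpos, ← hf, ← hf]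
  exact h _ _

theorem continuous_maxSlope (x : Fin (n + 1) → ℝ) : Continuous (maxSlope x) := by
  cases n with
  | zero => exact continuous_const.congr fun z => (Real.iSup_of_isEmpty _).symm
  | succ n =>
    have hsup : ∀ z, Finset.univ.sup' Finset.univ_nonempty (fun i : Fin (n + 1) =>
        |(z i.succ - z i.castSucc) / (x i.succ - x i.castSucc)|) = maxSlope x z :=
      fun z => Finset.sup'_univ_eq_ciSup _
    exact (Continuous.finset_sup'_apply _ fun i _ => by fun_prop).congr hsup

theorem convexOn_maxSlope (x : Fin (n + 1) → ℝ) : ConvexOn ℝ univ (maxSlope x) := by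
  refine ⟨convex_univ, fun z _ w _ a b ha hb _ => Real.iSup_le (fun i => ?_) ?_⟩
  · simp only [Pi.add_apply, Pi.smul_apply, smul_eq_mul]
    set d := x i.succ - x i.castSucc
    calc |(a * z i.succ + b * w i.succ - (a * z i.castSucc + b * w i.castSucc)) / d|
        = |a * ((z i.succ - z i.castSucc) / d) + b * ((w i.succ - w i.castSucc) / d)| := by
          ring_nf
      _ ≤ a * |(z i.succ - z i.castSucc) / d| + b * |(w i.succ - w i.castSucc) / d| := by
          simpa only [abs_mul, abs_of_nonneg ha, abs_of_nonneg hb] using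
            abs_add_le (a * ((z i.succ - z i.castSucc) / d)) (b * ((w i.succ - w i.castSucc) / d))
      _ ≤ a * maxSlope x z + b * maxSlope x w :=
          add_le_add (mul_le_mul_of_nonneg_left (abs_slope_le_maxSlope x z i) ha)
            (mul_le_mul_of_nonneg_left (abs_slope_le_maxSlope x w i) hb)
  · exact add_nonneg (mul_nonneg ha (maxSlope_nonneg x z)) (mul_nonneg hb (maxSlope_nonneg x w))

end MaxSlope

section LipInterpSolutions

variable {n : ℕ} {x z : Fin (n + 1) → ℝ} {f : LipR}

theorem mem_lipInterpSolutions_iff (hx : StrictMono x) :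
    f ∈ lipInterpSolutions x z ↔ Interpolates x z f ∧
      ∀ s t, |(f : ℝ → ℝ) s - (f : ℝ → ℝ) t| ≤ maxSlope x z * |s - t| := by
  refine ⟨fun ⟨hfi, hmin⟩ => ⟨hfi, fun s t => ?_⟩, fun ⟨hfi, hf⟩ => ⟨hfi, fun g hgi => ?_⟩⟩
  · obtain ⟨g, hg, hgi⟩ :=
      exists_lipschitz_interpolation (maxSlope_nonneg x z) (abs_sub_le_maxSlope_mul hx z)
    have hL : lipConst f ≤ maxSlope x z :=
      (hmin ⟨g, mem_LipR_of_abs_sub_le hg⟩ hgi).trans (lipConst_le hg)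
    exact (abs_sub_le_lipConst_mul f.2 s t).trans (mul_le_mul_of_nonneg_right hL (abs_nonneg _))
  · exact (lipConst_le hf).trans (maxSlope_le_of_interpolates hx hgi (abs_sub_le_lipConst_mul g.2))

theorem exists_mem_lipInterpSolutions {f : ℝ → ℝ} (hx : StrictMono x)
    (hf : ∀ s t, |f s - f t| ≤ maxSlope x z * |s - t|) (hfi : Interpolates x z f) :
    ∃ hf : f ∈ LipR, (⟨f, hf⟩ : LipR) ∈ lipInterpSolutions x z :=
  ⟨mem_LipR_of_abs_sub_le hf, (mem_lipInterpSolutions_iff hx).2 ⟨hfi, hf⟩⟩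

theorem nonempty_lipInterpSolutions (hx : StrictMono x) (z : Fin (n + 1) → ℝ) :
    (lipInterpSolutions x z).Nonempty := by
  obtain ⟨f, hf, hfi⟩ :=
    exists_lipschitz_interpolation (maxSlope_nonneg x z) (abs_sub_le_maxSlope_mul hx z)
  obtain ⟨hfL, hfV⟩ := exists_mem_lipInterpSolutions hx hf hfi
  exact ⟨_, hfV⟩

theorem lipConst_eq_maxSlope (hx : StrictMono x) (hf : f ∈ lipInterpSolutions x z) :
    lipConst f = maxSlope x z :=
  (lipConst_le ((mem_lipInterpSolutions_iff hx).1 hf).2).antisymm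
    (maxSlope_le_of_interpolates hx hf.1 (abs_sub_le_lipConst_mul f.2))

theorem convex_lipInterpSolutions (hx : StrictMono x) (z : Fin (n + 1) → ℝ) :
    Convex ℝ (lipInterpSolutions x z) := by
  intro f hf g hg a b ha hb hab
  rw [mem_lipInterpSolutions_iff hx] at hf hg ⊢
  refine ⟨fun m => ?_, fun s t => abs_le.2 ?_⟩ <;>
    simp only [Submodule.coe_add, Submodule.coe_smul, Pi.add_apply, Pi.smul_apply]
  · rw [hf.1 m, hg.1 m, Convex.combo_self hab]
  · rw [add_sub_add_comm, ← smul_sub, ← smul_sub]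
    exact convex_Icc _ _ (abs_le.1 (hf.2 s t)) (abs_le.1 (hg.2 s t)) ha hb hab

end LipInterpSolutions

section OptimalValues

theorem strictConvexOn_sum_apply {ι : Type*} [Fintype ι] {φ : ι → ℝ → ℝ}
    (hφ : ∀ i, StrictConvexOn ℝ univ (φ i)) :
    StrictConvexOn ℝ univ fun z : ι → ℝ => ∑ i, φ i (z i) := by
  refine ⟨convex_univ, fun z _ w _ hzw a b ha hb hab => ?_⟩
  obtain ⟨k, hk⟩ := Function.ne_iff.1 hzw
  simp only [Finset.smul_sum, ← Finset.sum_add_distrib]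
  exact Finset.sum_lt_sum
    (fun i _ => (hφ i).convexOn.2 (mem_univ (z i)) (mem_univ (w i)) ha.le hb.le hab)
    ⟨k, Finset.mem_univ k, (hφ k).2 (mem_univ (z k)) (mem_univ (w k)) hk ha hb hab⟩

theorem tendsto_sum_apply_cocompact_atTop {ι : Type*} [Fintype ι] {φ : ι → ℝ → ℝ}
    (hφ : ∀ i, Continuous (φ i)) (hlim : ∀ i, Tendsto (φ i) (cocompact ℝ) atTop) :
    Tendsto (fun z : ι → ℝ => ∑ i, φ i (z i)) (cocompact (ι → ℝ)) atTop := by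
  classical
  choose u hu using fun i => (hφ i).exists_forall_le (hlim i)
  rw [← Filter.coprodᵢ_cocompact, Filter.coprodᵢ, tendsto_iSup]
  refine fun k => tendsto_atTop_mono (fun z => ?_) (tendsto_atTop_add_const_right _
    (∑ i ∈ Finset.univ.erase k, φ i (u i)) ((hlim k).comp tendsto_comap))
  rw [← Finset.add_sum_erase _ _ (Finset.mem_univ k)]
  exact add_le_add le_rfl (Finset.sum_le_sum fun i _ => hu i (z i))

variable {n : ℕ} {E : ℝ → ℝ → ℝ} {lam : ℝ} {x y z : Fin (n + 1) → ℝ}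

/-- The smallest cost of a Lipschitz function with values `z` at the data points. -/
noncomputable def valueCost (E : ℝ → ℝ → ℝ) (lam : ℝ) (x y z : Fin (n + 1) → ℝ) : ℝ :=
  ∑ m, E (z m) (y m) + lam * maxSlope x z

theorem exists_isMinOn_valueCost (hE_convex : ∀ v, StrictConvexOn ℝ univ (fun u => E u v))
    (hE_coercive : ∀ v, Tendsto (fun u => E u v) (cocompact ℝ) atTop) (hlam : 0 ≤ lam)
    (x y : Fin (n + 1) → ℝ) : ∃ z, IsMinOn (valueCost E lam x y) univ z := by
  have hE : ∀ v, Continuous fun u => E u v := fun v =>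
    continuousOn_univ.1 ((hE_convex v).convexOn.continuousOn isOpen_univ)
  have hcont : Continuous (valueCost E lam x y) :=
    (continuous_finsetSum _ fun m _ => (hE (y m)).comp (continuous_apply m)).add
      (continuous_const.mul (continuous_maxSlope x))
  have hlim : Tendsto (valueCost E lam x y) (cocompact _) atTop :=
    tendsto_atTop_mono (fun z => le_add_of_nonneg_right (mul_nonneg hlam (maxSlope_nonneg x z)))
      (tendsto_sum_apply_cocompact_atTop (fun m => hE (y m)) fun m => hE_coercive (y m))
  exact (hcont.exists_forall_le hlim).imp fun z hz => isMinOn_univ_iff.2 hz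

theorem strictConvexOn_valueCost (hE_convex : ∀ v, StrictConvexOn ℝ univ (fun u => E u v))
    (hlam : 0 ≤ lam) (x y : Fin (n + 1) → ℝ) : StrictConvexOn ℝ univ (valueCost E lam x y) :=
  (strictConvexOn_sum_apply fun m => hE_convex (y m)).add_convexOn
    ((convexOn_maxSlope x).smul hlam)

theorem valueCost_le_lipCost (hlam : 0 ≤ lam) (hx : StrictMono x) (f : LipR) :
    valueCost E lam x y (fun m => (f : ℝ → ℝ) (x m)) ≤ lipCost E lam x y f :=
  add_le_add le_rfl (mul_le_mul_of_nonneg_left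
    (maxSlope_le_of_interpolates hx (fun _ => rfl) (abs_sub_le_lipConst_mul f.2)) hlam)

theorem lipSolutions_eq_lipInterpSolutions
    (hE_convex : ∀ v, StrictConvexOn ℝ univ (fun u => E u v)) (hlam : 0 < lam) (hx : StrictMono x)
    (hz : IsMinOn (valueCost E lam x y) univ z) :
    lipSolutions E lam x y = lipInterpSolutions x z := by
  have hval : ∀ g ∈ lipInterpSolutions x z, lipCost E lam x y g = valueCost E lam x y z :=
    fun g hg => by
      rw [lipCost, valueCost, lipConst_eq_maxSlope hx hg]
      simp only [hg.1 _]
  have hlow := valueCost_le_lipCost (E := E) (y := y) hlam.le hx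
  refine Subset.antisymm (fun f hf => ?_) fun f hf g => ?_
  · obtain ⟨g, hg⟩ := nonempty_lipInterpSolutions hx z
    have hfg : lipCost E lam x y f ≤ valueCost E lam x y z := (hf g).trans_eq (hval g hg)
    have hfz : (fun m => (f : ℝ → ℝ) (x m)) = z :=
      (strictConvexOn_valueCost hE_convex hlam.le x y).eq_of_isMinOn
        (fun w _ => ((hlow f).trans hfg).trans (hz (mem_univ w))) hz (mem_univ _) (mem_univ _)
    have hfi : Interpolates x z f := congrFun hfz
    rw [lipCost, valueCost] at hfg
    simp only [hfi _, add_le_add_iff_left, mul_le_mul_iff_right₀ hlam] at hfg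
    exact (mem_lipInterpSolutions_iff hx).2 ⟨hfi, fun s t =>
      (abs_sub_le_lipConst_mul f.2 s t).trans (mul_le_mul_of_nonneg_right hfg (abs_nonneg _))⟩
  · rw [hval f hf]
    exact (hz (mem_univ _)).trans (hlow g)

end OptimalValues

section Cones

variable {M : ℕ} {L : ℝ} {p q : ℝ × ℝ}

theorem mem_vadd_rightCone_iff (hL : 0 ≤ L) :
    p ∈ q +ᵥ rightCone L ↔ q.1 ≤ p.1 ∧ |p.2 - q.2| ≤ L * (p.1 - q.1) := by
  have hcone : p ∈ q +ᵥ rightCone L ↔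
      ∃ a b : ℝ, 0 ≤ a ∧ 0 ≤ b ∧ p.1 - q.1 = a + b ∧ p.2 - q.2 = L * a - L * b := by
    rw [mem_vadd_set_iff_neg_vadd_mem]
    simp [rightCone, Prod.ext_iff, neg_add_eq_sub, mul_comm L, sub_eq_add_neg]
  rw [hcone]
  constructor
  · rintro ⟨a, b, ha, hb, h₁, h₂⟩
    refine ⟨by linarith, ?_⟩
    rw [h₁, h₂, ← mul_sub, abs_mul, abs_of_nonneg hL]
    exact mul_le_mul_of_nonneg_left (abs_sub_le_iff.2 ⟨by linarith, by linarith⟩) hL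
  · rintro ⟨h₁, h₂⟩
    obtain ⟨c, hc, hcp⟩ : ∃ c, |c| ≤ p.1 - q.1 ∧ L * c = p.2 - q.2 := by
      refine ⟨(p.2 - q.2) / L, ?_, mul_div_cancel_of_imp' fun hL₀ => ?_⟩
      · rw [abs_div, abs_of_nonneg hL]
        exact div_le_of_le_mul₀ hL (sub_nonneg.2 h₁) (by rwa [mul_comm])
      · rwa [hL₀, zero_mul, abs_nonpos_iff] at h₂
    obtain ⟨hc₁, hc₂⟩ := abs_le.1 hc
    exact ⟨(p.1 - q.1 + c) / 2, (p.1 - q.1 - c) / 2, by linarith, by linarith, by ring,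
      by rw [← hcp]; ring⟩

theorem mem_vadd_leftCone_iff (hL : 0 ≤ L) :
    p ∈ q +ᵥ leftCone L ↔ p.1 ≤ q.1 ∧ |p.2 - q.2| ≤ L * (q.1 - p.1) := by
  have hswap : p ∈ q +ᵥ leftCone L ↔ q ∈ p +ᵥ rightCone L := by
    simp only [mem_vadd_set_iff_neg_vadd_mem, leftCone, Set.mem_neg, vadd_eq_add, neg_add_rev,
      neg_neg]
  rw [hswap, mem_vadd_rightCone_iff hL, abs_sub_comm]

theorem mem_rightConeAt_iff (x z : Fin M → ℝ) (hL : 0 ≤ L) (m : ℕ) :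
    p ∈ rightConeAt x z L m ↔ ∀ k : Fin M, m = k + 1 →
      x k ≤ p.1 ∧ |p.2 - z k| ≤ L * (p.1 - x k) := by
  rw [rightConeAt]
  split_ifs with hm
  · rw [mem_vadd_rightCone_iff hL]
    exact ⟨by rintro h k rfl; exact h, fun h => h ⟨m - 1, by lia⟩ (by grind)⟩
  · exact iff_of_true (mem_univ p) fun k hk => absurd ⟨by lia, by lia⟩ hm

theorem mem_leftConeAt_iff (x z : Fin M → ℝ) (hL : 0 ≤ L) (m : ℕ) :
    p ∈ leftConeAt x z L m ↔ ∀ k : Fin M, m = k + 1 →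
      p.1 ≤ x k ∧ |p.2 - z k| ≤ L * (x k - p.1) := by
  rw [leftConeAt]
  split_ifs with hm
  · rw [mem_vadd_leftCone_iff hL]
    exact ⟨by rintro h k rfl; exact h, fun h => h ⟨m - 1, by lia⟩ (by grind)⟩
  · exact iff_of_true (mem_univ p) fun k hk => absurd ⟨by lia, by lia⟩ hm

theorem exists_mem_rightConeAt_inter_leftConeAt (x z : Fin M → ℝ) (hL : 0 ≤ L)
    (hp : ∀ k, |p.2 - z k| ≤ L * |p.1 - x k|) :
    ∃ m ∈ Finset.Icc 1 (M + 1), p ∈ rightConeAt x z L (m - 1) ∩ leftConeAt x z L m := by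
  have hright : ∀ k, x k ≤ p.1 → x k ≤ p.1 ∧ |p.2 - z k| ≤ L * (p.1 - x k) := fun k hk =>
    ⟨hk, abs_of_nonneg (sub_nonneg.2 hk) ▸ hp k⟩
  have hleft : ∀ k, p.1 ≤ x k → p.1 ≤ x k ∧ |p.2 - z k| ≤ L * (x k - p.1) := fun k hk =>
    ⟨hk, abs_of_nonneg (sub_nonneg.2 hk) ▸ abs_sub_comm p.1 (x k) ▸ hp k⟩
  simp only [mem_inter_iff, mem_rightConeAt_iff x z hL, mem_leftConeAt_iff x z hL, Finset.mem_Icc]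
  rcases Set.eq_empty_or_nonempty {k | p.1 ≤ x k} with hempty | hne
  · refine ⟨M + 1, by lia, fun k _ => hright k (le_of_not_ge fun hk => ?_), fun k hk => by lia⟩
    exact hempty.subset hk
  · obtain ⟨k, hk, hmin⟩ := wellFounded_lt.has_min _ hne
    refine ⟨k + 1, by lia, fun j hj => hright j (le_of_not_ge fun hj' => hmin j hj' ?_),
      fun j hj => ?_⟩
    · lia
    · obtain rfl : j = k := by lia
      exact hleft j hk

theorem abs_sub_le_of_mem_rightConeAt_inter_leftConeAt {x z : Fin M → ℝ} (hx : Monotone x)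
    (hL : 0 ≤ L) (hz : ∀ i j, |z i - z j| ≤ L * |x i - x j|) {m : ℕ}
    (hm : m ∈ Finset.Icc 1 (M + 1))
    (hp : p ∈ rightConeAt x z L (m - 1) ∩ leftConeAt x z L m) (k : Fin M) :
    |p.2 - z k| ≤ L * |p.1 - x k| := by
  obtain ⟨hright, hleft⟩ := hp
  rw [mem_rightConeAt_iff x z hL] at hright
  rw [mem_leftConeAt_iff x z hL] at hleft
  rw [Finset.mem_Icc] at hm
  have htri : ∀ i, |p.2 - z k| ≤ |p.2 - z i| + L * |x i - x k| := fun i =>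
    (abs_sub_le _ _ _).trans (add_le_add_right (hz i k) _)
  rcases lt_or_ge (k + 1 : ℕ) m with hkm | hkm
  · let i : Fin M := ⟨m - 2, by lia⟩
    obtain ⟨hi, hpi⟩ := hright i (by grind)
    have hki : x k ≤ x i := hx (Fin.mk_le_mk.2 (by lia))
    have := htri i
    rw [abs_of_nonneg (sub_nonneg.2 hki)] at this
    rw [abs_of_nonneg (sub_nonneg.2 (hki.trans hi))]
    linarith
  · let i : Fin M := ⟨m - 1, by lia⟩
    obtain ⟨hi, hpi⟩ := hleft i (by grind)
    have hik : x i ≤ x k := hx (Fin.mk_le_mk.2 (by lia))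
    have := htri i
    rw [abs_of_nonpos (sub_nonpos.2 hik)] at this
    rw [abs_of_nonpos (sub_nonpos.2 (hi.trans hik))]
    linarith

variable {n : ℕ} {x : Fin (n + 1) → ℝ}

theorem mem_unionGraph_lipInterpSolutions_iff (hx : StrictMono x) (z : Fin (n + 1) → ℝ) :
    p ∈ unionGraph (lipInterpSolutions x z) ↔ ∀ k, |p.2 - z k| ≤ maxSlope x z * |p.1 - x k| := by
  constructor
  · rintro ⟨f, hf, hp⟩ k
    obtain ⟨hfi, hfL⟩ := (mem_lipInterpSolutions_iff hx).1 hf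
    rw [hp, ← hfi k]
    exact hfL p.1 (x k)
  · intro hp
    obtain ⟨f, hf, hfi⟩ := exists_lipschitz_interpolation (X := fun i : Option _ => i.elim p.1 x)
      (Z := fun i => i.elim p.2 z) (maxSlope_nonneg x z) (by
        rintro (_ | i) (_ | j)
        · simp
        · exact hp j
        · simpa only [Option.elim, abs_sub_comm] using hp i
        · exact abs_sub_le_maxSlope_mul hx z i j)
    obtain ⟨hfL, hfV⟩ := exists_mem_lipInterpSolutions hx hf fun m => hfi (some m)
    exact ⟨_, hfV, (hfi none).symm⟩

theorem unionGraph_lipInterpSolutions (hx : StrictMono x) (z : Fin (n + 1) → ℝ) :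
    unionGraph (lipInterpSolutions x z) =
      ⋃ m ∈ Finset.Icc 1 (n + 1 + 1),
        rightConeAt x z (maxSlope x z) (m - 1) ∩ leftConeAt x z (maxSlope x z) m := by
  have hL := maxSlope_nonneg x z
  ext p
  rw [mem_unionGraph_lipInterpSolutions_iff hx]
  refine ⟨fun hp => mem_iUnion₂.2 ?_, fun hp k => ?_⟩
  · simpa only [exists_prop] using exists_mem_rightConeAt_inter_leftConeAt x z hL hp
  · obtain ⟨m, hm, hpm⟩ := mem_iUnion₂.1 hp
    exact abs_sub_le_of_mem_rightConeAt_inter_leftConeAt hx.monotone hL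
      (abs_sub_le_maxSlope_mul hx z) hm hpm k

end Cones

section WeakStar

variable {F : ℕ → ℝ → ℝ} {f g : ℝ → ℝ} {K : ℝ≥0}

theorem integral_deriv_mul_eq_neg_integral_mul_deriv (hf : LipschitzWith K f)
    (hg : ContDiff ℝ ∞ g) (hc : HasCompactSupport g) :
    ∫ t, deriv f t * g t = -∫ t, f t * deriv g t := by
  obtain ⟨C, hC⟩ := hg.lipschitzWith_of_hasCompactSupport hc (by simp)
  have hline : ∀ (u : ℝ → ℝ) (t : ℝ), lineDeriv ℝ u t 1 = deriv u t := fun u t => by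
    simp [lineDeriv, deriv_comp_const_add]
  have hparts := hf.integral_lineDeriv_mul_eq (μ := volume) hC hc (1 : ℝ)
  simp only [lineDeriv_neg, hline] at hparts
  rw [hparts, ← integral_neg]
  exact integral_congr_ae (Eventually.of_forall fun t => by ring)

theorem lipschitzWith_integral_deriv_mul (hf : LipschitzWith K f) :
    LipschitzWith K fun g : Lp ℝ 1 (volume : Measure ℝ) => ∫ t, deriv f t * g t := by
  refine LipschitzWith.of_dist_le_mul fun g h => ?_
  have hint := LipR.integrable_deriv_mul ⟨f, K, hf⟩
  rw [dist_eq_norm, ← integral_sub (hint g) (hint h), dist_eq_norm, L1.norm_eq_integral_norm,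
    ← integral_const_mul]
  refine norm_integral_le_of_norm_le ((L1.integrable_coeFn (g - h)).norm.const_mul _) ?_
  filter_upwards [Lp.coeFn_sub g h] with t ht
  rw [ht, Pi.sub_apply, ← mul_sub, norm_mul]
  exact mul_le_mul_of_nonneg_right (norm_deriv_le_of_lipschitz hf) (norm_nonneg _)

theorem tendsto_integral_mul_of_lipschitzWith (hF : ∀ n, LipschitzWith K (F n))
    (hlim : ∀ t, Tendsto (fun n => F n t) atTop (𝓝 (f t)))
    (hg : Integrable g) (hg₁ : Integrable fun t => t * g t) :
    Tendsto (fun n => ∫ t, F n t * g t) atTop (𝓝 (∫ t, f t * g t)) := by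
  obtain ⟨A, hA⟩ := (hlim 0).norm.bddAbove_range
  refine tendsto_integral_of_dominated_convergence (fun t => A * ‖g t‖ + K * ‖t * g t‖)
    (fun n => (hF n).continuous.aestronglyMeasurable.mul hg.1)
    ((hg.norm.const_mul A).add (hg₁.norm.const_mul _))
    (fun n => Eventually.of_forall fun t => ?_) (Eventually.of_forall fun t => (hlim t).mul_const _)
  have hFt : ‖F n t‖ ≤ A + K * ‖t‖ := by
    have h₀ : ‖F n 0‖ ≤ A := hA (mem_range_self n)
    have ht : ‖F n t - F n 0‖ ≤ K * ‖t - 0‖ := (hF n).norm_sub_le t 0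
    rw [sub_zero] at ht
    linarith [norm_le_insert' (F n t) (F n 0)]
  rw [norm_mul, norm_mul, ← mul_assoc, ← add_mul]
  exact mul_le_mul_of_nonneg_right hFt (norm_nonneg _)

theorem tendsto_integral_deriv_mul_of_lipschitzWith (hF : ∀ n, LipschitzWith K (F n))
    (hlim : ∀ t, Tendsto (fun n => F n t) atTop (𝓝 (f t))) (g : Lp ℝ 1 (volume : Measure ℝ)) :
    Tendsto (fun n => ∫ t, deriv (F n) t * g t) atTop (𝓝 (∫ t, deriv f t * g t)) := by
  have hf : LipschitzWith K f :=
    (isClosed_setOfPred_lipschitzWith K).mem_of_tendsto (tendsto_pi_nhds.2 hlim)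
      (Eventually.of_forall hF)
  have hclosed : IsClosed {g : Lp ℝ 1 (volume : Measure ℝ) |
      Tendsto (fun n => ∫ t, deriv (F n) t * g t) atTop (𝓝 (∫ t, deriv f t * g t))} :=
    (LipschitzWith.uniformEquicontinuous _ K fun n =>
      lipschitzWith_integral_deriv_mul (hF n)).equicontinuous.isClosed_setOfPred_tendsto
      (lipschitzWith_integral_deriv_mul hf).continuous
  refine hclosed.closure_subset_iff.2 ?_ (Lp.dense_hasCompactSupport_contDiff ENNReal.one_ne_top g)
  rintro g ⟨h, hgh, hc, hh⟩
  have hcongr : ∀ u : ℝ → ℝ, LipschitzWith K u →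
      ∫ t, deriv u t * g t = -∫ t, u t * deriv h t := fun u hu => by
    rw [← integral_deriv_mul_eq_neg_integral_mul_deriv hu hh hc]
    exact integral_congr_ae (hgh.mono fun t ht => congrArg (deriv u t * ·) ht)
  have hh' : Continuous (deriv h) := (contDiff_infty_iff_deriv.1 hh).2.continuous
  rw [mem_ofPred, hcongr f hf]
  simp only [hcongr _ (hF _)]
  exact (tendsto_integral_mul_of_lipschitzWith hF hlim
    (hh'.integrable_of_hasCompactSupport hc.deriv)
    ((continuous_id.mul hh').integrable_of_hasCompactSupport hc.deriv.mul_left)).neg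

theorem tendsto_lipPairing {F : ℕ → LipR} {f : LipR} (hF : ∀ n, LipschitzWith K (F n : ℝ → ℝ))
    (hlim : ∀ t, Tendsto (fun n => (F n : ℝ → ℝ) t) atTop (𝓝 ((f : ℝ → ℝ) t)))
    (w : Lp ℝ 1 (volume : Measure ℝ) × ℝ) :
    Tendsto (fun n => lipPairing (F n) w) atTop (𝓝 (lipPairing f w)) := by
  have hexp : Integrable fun t : ℝ => Real.exp (-t ^ 2) := by
    simpa using integrable_exp_neg_mul_sq one_pos
  have hmulexp : Integrable fun t : ℝ => t * Real.exp (-t ^ 2) := by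
    simpa using integrable_mul_exp_neg_mul_sq one_pos
  exact (tendsto_integral_deriv_mul_of_lipschitzWith hF hlim w.1).neg.add
    ((tendsto_integral_mul_of_lipschitzWith hF hlim hexp hmulexp).const_mul w.2)

theorem isCompact_setOf_continuousMap_lipschitzWith {S : Set (ℝ → ℝ)} (hS : IsClosed S)
    (hK : ∀ f ∈ S, LipschitzWith K f) {a : ℝ} (ha : Bornology.IsBounded ((· a) '' S)) :
    IsCompact {f : C(ℝ, ℝ) | ⇑f ∈ S} := by
  refine ArzelaAscoli.isCompact_of_equicontinuous _ ?_
    (LipschitzWith.uniformEquicontinuous _ K fun f => hK _ f.2).equicontinuous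
  have himg : ContinuousMap.toFun '' {f : C(ℝ, ℝ) | ⇑f ∈ S} = S :=
    (image_subset_iff.2 fun f hf => hf).antisymm fun f hf => ⟨⟨f, (hK f hf).continuous⟩, hf, rfl⟩
  obtain ⟨A, hA⟩ := ha.exists_norm_le
  rw [himg]
  have hbox : IsCompact (univ.pi fun t => Metric.closedBall (0 : ℝ) (A + K * ‖t - a‖)) :=
    isCompact_univ_pi fun _ => isCompact_closedBall _ _
  refine hbox.of_isClosed_subset hS fun f hf t _ => ?_
  have hfa : ‖f a‖ ≤ A := hA _ (mem_image_of_mem _ hf)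
  rw [mem_closedBall_zero_iff]
  linarith [norm_le_insert' (f t) (f a), (hK f hf).norm_sub_le t a]

theorem isWeakStarCompact_of_isClosed {S : Set (ℝ → ℝ)} (hS : IsClosed S)
    (hK : ∀ f ∈ S, LipschitzWith K f) {a : ℝ} (ha : Bornology.IsBounded ((· a) '' S)) :
    IsWeakStarCompact {f : LipR | (f : ℝ → ℝ) ∈ S} := by
  let T : Set C(ℝ, ℝ) := {f | ⇑f ∈ S}
  have : CompactSpace T :=
    isCompact_iff_compactSpace.1 (isCompact_setOf_continuousMap_lipschitzWith hS hK ha)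
  let Φ : T → LipR := fun f => ⟨f.1, K, hK _ f.2⟩
  have hΦ : @Continuous T LipR _ lipWeakStar Φ := by
    refine continuous_induced_rng.2 (continuous_pi fun w => ?_)
    refine continuous_iff_seqContinuous.2 fun F f hFf => ?_
    refine tendsto_lipPairing (F := fun n => Φ (F n)) (f := Φ f) (fun n => hK _ (F n).2)
      (fun t => ?_) w
    exact ((ContinuousEvalConst.continuous_eval_const t).comp
      continuous_subtype_val).continuousAt.tendsto.comp hFf
  have hrange : range Φ = {f : LipR | (f : ℝ → ℝ) ∈ S} :=
    (range_subset_iff.2 fun f => f.2).antisymm fun f hf =>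
      ⟨⟨⟨f, (hK f hf).continuous⟩, hf⟩, rfl⟩
  rw [← hrange]
  exact @isCompact_range _ _ _ lipWeakStar _ _ hΦ

theorem isWeakStarCompact_lipInterpSolutions {n : ℕ} {x : Fin (n + 1) → ℝ} (hx : StrictMono x)
    (z : Fin (n + 1) → ℝ) : IsWeakStarCompact (lipInterpSolutions x z) := by
  have hiff : ∀ f : LipR, f ∈ lipInterpSolutions x z ↔
      (f : ℝ → ℝ) ∈ {f | Interpolates x z f} ∩ {f | LipschitzWith (maxSlope x z).toNNReal f} :=
    fun f => by
      rw [mem_lipInterpSolutions_iff hx, ← lipschitzWith_toNNReal_iff (maxSlope_nonneg x z)]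
      rfl
  rw [Set.ext hiff]
  refine isWeakStarCompact_of_isClosed (.inter ?_ (isClosed_setOfPred_lipschitzWith _))
    (fun f hf => hf.2) (a := x 0) (Bornology.IsBounded.subset Bornology.isBounded_singleton
      (image_subset_iff.2 fun f hf => hf.1 0))
  simp only [Interpolates, ofPred_forall]
  exact isClosed_iInter fun m => isClosed_eq (continuous_apply _) continuous_const

end WeakStar

section TV2

variable {f g φ : ℝ → ℝ}

theorem ofReal_integral_mul_deriv_deriv_le_TV2 (hφ : ContDiff ℝ ∞ φ) (hc : HasCompactSupport φ)
    (hφ₁ : ∀ t, |φ t| ≤ 1) (f : ℝ → ℝ) :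
    ENNReal.ofReal (∫ t, f t * deriv (deriv φ) t) ≤ TV2 f :=
  le_iSup₂_of_le φ hφ <| le_iSup₂_of_le hc hφ₁ le_rfl

theorem TV2_le_iff {C : ℝ≥0∞} :
    TV2 f ≤ C ↔ ∀ φ : ℝ → ℝ, ContDiff ℝ ∞ φ → HasCompactSupport φ → (∀ t, |φ t| ≤ 1) →
      ENNReal.ofReal (∫ t, f t * deriv (deriv φ) t) ≤ C := by
  simp only [TV2, iSup_le_iff]

theorem integrable_mul_deriv_deriv (hf : Continuous f) (hφ : ContDiff ℝ ∞ φ)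
    (hc : HasCompactSupport φ) : Integrable fun t => f t * deriv (deriv φ) t := by
  have hφ'' : Continuous (deriv (deriv φ)) :=
    (contDiff_infty_iff_deriv.1 (contDiff_infty_iff_deriv.1 hφ).2).2.continuous
  exact (hf.mul hφ'').integrable_of_hasCompactSupport hc.deriv.deriv.mul_left

theorem hasDerivAt_affine_mul_deriv_sub (hφ : ContDiff ℝ ∞ φ) (α β t : ℝ) :
    HasDerivAt (fun t => (α + β * t) * deriv φ t - β * φ t)
      ((α + β * t) * deriv (deriv φ) t) t := by
  have hφ' : HasDerivAt φ (deriv φ t) t := (hφ.differentiable (by simp) t).hasDerivAt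
  have hφ'' : HasDerivAt (deriv φ) (deriv (deriv φ) t) t :=
    ((contDiff_infty_iff_deriv.1 hφ).2.differentiable (by simp) t).hasDerivAt
  have haff : HasDerivAt (fun t => α + β * t) β t := by
    simpa using ((hasDerivAt_id t).const_mul β).const_add α
  exact ((haff.mul hφ'').sub (hφ'.const_mul β)).congr_deriv (by ring)

theorem integral_affine_mul_deriv_deriv (hφ : ContDiff ℝ ∞ φ) (hc : HasCompactSupport φ)
    (α β : ℝ) : ∫ t, (α + β * t) * deriv (deriv φ) t = 0 := by
  have hφ' : Continuous (deriv φ) := (contDiff_infty_iff_deriv.1 hφ).2.continuous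
  have hφ₀ := hφ.continuous
  exact integral_eq_zero_of_hasDerivAt_of_integrable (hasDerivAt_affine_mul_deriv_sub hφ α β)
    (integrable_mul_deriv_deriv (by fun_prop) hφ hc)
    (Continuous.integrable_of_hasCompactSupport (by fun_prop) (hc.deriv.mul_left.sub hc.mul_left))

theorem integral_hinge_mul_deriv_deriv (hφ : ContDiff ℝ ∞ φ) (hc : HasCompactSupport φ) (a : ℝ) :
    ∫ t, max (a - t) 0 * deriv (deriv φ) t = φ a := by
  have hind : (fun t => max (a - t) 0 * deriv (deriv φ) t) =
      (Iic a).indicator fun t => (a + -1 * t) * deriv (deriv φ) t := by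
    funext t
    by_cases h : t ≤ a
    · rw [indicator_of_mem (mem_Iic.2 h), max_eq_left (sub_nonneg.2 h)]
      ring
    · rw [indicator_of_notMem (mt mem_Iic.1 h), max_eq_right (by linarith), zero_mul]
  have hlim : Tendsto (fun t => (a + -1 * t) * deriv φ t - -1 * φ t) atBot (𝓝 0) :=
    (hc.deriv.mul_left.sub hc.mul_left).is_zero_at_infty.mono_left atBot_le_cocompact
  rw [hind, integral_indicator measurableSet_Iic,
    integral_Iic_of_hasDerivAt_of_tendsto' (fun t _ => hasDerivAt_affine_mul_deriv_sub hφ a (-1) t)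
      (integrable_mul_deriv_deriv (by fun_prop) hφ hc).integrableOn hlim]
  ring

theorem TV2_neg (f : ℝ → ℝ) : TV2 (-f) = TV2 f := by
  have hle : ∀ f : ℝ → ℝ, TV2 (-f) ≤ TV2 f := fun f =>
    TV2_le_iff.2 fun φ hφ hc hφ₁ => by
      simpa using ofReal_integral_mul_deriv_deriv_le_TV2 hφ.neg hc.neg (by simpa using hφ₁) f
  exact (hle f).antisymm (by simpa using hle (-f))

theorem TV2_add_le (hf : Continuous f) (hg : Continuous g) :
    TV2 (fun t => f t + g t) ≤ TV2 f + TV2 g := by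
  refine TV2_le_iff.2 fun φ hφ hc hφ₁ => ?_
  simp only [add_mul]
  rw [integral_add (integrable_mul_deriv_deriv hf hφ hc) (integrable_mul_deriv_deriv hg hφ hc)]
  exact ENNReal.ofReal_add_le.trans <| add_le_add
    (ofReal_integral_mul_deriv_deriv_le_TV2 hφ hc hφ₁ f)
    (ofReal_integral_mul_deriv_deriv_le_TV2 hφ hc hφ₁ g)

theorem TV2_affine (α β : ℝ) : TV2 (fun t => α + β * t) = 0 :=
  le_zero_iff.1 <| TV2_le_iff.2 fun φ hφ hc _ => by
    rw [integral_affine_mul_deriv_deriv hφ hc, ENNReal.ofReal_zero]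

theorem TV2_const_mul_hinge_le (w a : ℝ) :
    TV2 (fun t => w * max (a - t) 0) ≤ ENNReal.ofReal |w| := by
  refine TV2_le_iff.2 fun φ hφ hc hφ₁ => ENNReal.ofReal_le_ofReal ?_
  simp only [mul_assoc]
  rw [integral_const_mul, integral_hinge_mul_deriv_deriv hφ hc]
  calc w * φ a ≤ |w * φ a| := le_abs_self _
    _ = |w| * |φ a| := abs_mul w (φ a)
    _ ≤ |w| := mul_le_of_le_one_right (abs_nonneg w) (hφ₁ a)

end TV2

section Slopes

/-- The total variation `∑ |aᵢ₊₁ - aᵢ|` of a finite sequence. -/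
def listVariation : List ℝ → ℝ
  | a :: b :: l => |b - a| + listVariation (b :: l)
  | _ => 0

/-- The slopes of `f` between consecutive points of a list. -/
noncomputable def slopes (f : ℝ → ℝ) : List ℝ → List ℝ
  | a :: b :: P => slope f a b :: slopes f (b :: P)
  | _ => []

/-- The total variation of the slopes of `f` between consecutive points of a list; for an
increasing list, this is the second-order total variation of the piecewise-linear
interpolant. -/
noncomputable def slopeVariation (f : ℝ → ℝ) (P : List ℝ) : ℝ :=
  listVariation (slopes f P)

variable {f g : ℝ → ℝ} {L : ℝ} {P : List ℝ}

theorem listVariation_nonneg : ∀ l : List ℝ, 0 ≤ listVariation l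
  | [] => le_rfl
  | [_] => le_rfl
  | _ :: b :: l => add_nonneg (abs_nonneg _) (listVariation_nonneg (b :: l))

theorem listVariation_append_cons (a : ℝ) (l : List ℝ) : ∀ u : List ℝ,
    listVariation (u ++ a :: l) = listVariation (u ++ [a]) + listVariation (a :: l)
  | [] => by simp [listVariation]
  | [b] => by simp [listVariation]
  | b :: c :: u => by
    have ih := listVariation_append_cons a l (c :: u)
    simp only [List.cons_append, listVariation] at ih ⊢
    rw [ih, add_assoc]

theorem listVariation_reverse : ∀ l : List ℝ, listVariation l.reverse = listVariation l
  | [] => rfl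
  | [_] => rfl
  | a :: b :: l => by
    have ih := listVariation_reverse (b :: l)
    rw [List.reverse_cons] at ih
    rw [List.reverse_cons, List.reverse_cons, List.append_assoc, List.singleton_append,
      listVariation_append_cons, ih]
    simp only [listVariation, abs_sub_comm a b]
    ring

theorem listVariation_concat (u : List ℝ) (a : ℝ) :
    listVariation (u ++ [a]) = listVariation (a :: u.reverse) := by
  rw [← listVariation_reverse, List.reverse_concat]

theorem listVariation_cons_le (l : List ℝ) (a b : ℝ) :
    listVariation (a :: l) ≤ listVariation (b :: l) + |a - b| := by
  cases l with
  | nil => simp [listVariation]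
  | cons c l =>
    simp only [listVariation]
    linarith [abs_sub_le c b a, abs_sub_comm a b]

theorem listVariation_cons_add_lt {l : List ℝ} {a b : ℝ} (hab : a < b) (hl : ∀ c ∈ l, c < b) :
    listVariation (a :: l) + a < listVariation (b :: l) + b := by
  cases l with
  | nil => simpa [listVariation] using hab
  | cons c l =>
    have hc : c < b := hl c List.mem_cons_self
    have hlt : |c - a| < b - c + (b - a) := abs_lt.2 ⟨by linarith, by linarith⟩
    simp only [listVariation]
    rw [abs_of_neg (sub_neg.2 hc)]
    linarith

theorem listVariation_le_cons (a : ℝ) : ∀ l, listVariation l ≤ listVariation (a :: l)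
  | [] => le_rfl
  | b :: _ => le_add_of_nonneg_left (abs_nonneg (b - a))

theorem listVariation_le_concat (l : List ℝ) (a : ℝ) :
    listVariation l ≤ listVariation (l ++ [a]) := by
  rw [listVariation_concat, ← listVariation_reverse]
  exact listVariation_le_cons a _

theorem mem_of_listVariation_cons_le {l : List ℝ} {a : ℝ} (hl : l ≠ [])
    (h : listVariation (a :: l) ≤ listVariation l) : a ∈ l := by
  cases l with
  | nil => exact absurd rfl hl
  | cons b l =>
    have hab : |b - a| ≤ 0 := by simpa [listVariation] using h
    rw [sub_eq_zero.1 (abs_nonpos_iff.1 hab)]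
    exact List.mem_cons_self

theorem mem_of_listVariation_concat_le {l : List ℝ} {a : ℝ} (hl : l ≠ [])
    (h : listVariation (l ++ [a]) ≤ listVariation l) : a ∈ l := by
  rw [listVariation_concat, ← listVariation_reverse l] at h
  exact List.mem_reverse.1 (mem_of_listVariation_cons_le (List.reverse_ne_nil_iff.2 hl) h)

theorem listVariation_le_append_pair (u w : List ℝ) {a b m : ℝ} (hm : m ∈ uIcc a b) :
    listVariation (u ++ m :: w) ≤ listVariation (u ++ a :: b :: w) := by
  rw [listVariation_append_cons, listVariation_append_cons a, listVariation_concat,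
    listVariation_concat u a]
  have hu := listVariation_cons_le u.reverse m a
  have hw := listVariation_cons_le w m b
  have hab : |m - a| + |m - b| = |b - a| := by
    rw [abs_sub_comm m b]
    rcases mem_uIcc.1 hm with ⟨h₁, h₂⟩ | ⟨h₁, h₂⟩
    · rw [abs_of_nonneg (sub_nonneg.2 h₁), abs_of_nonneg (sub_nonneg.2 h₂),
        abs_of_nonneg (by linarith)]
      ring
    · rw [abs_of_nonpos (sub_nonpos.2 h₂), abs_of_nonpos (sub_nonpos.2 h₁),
        abs_of_nonpos (by linarith)]
      ring
  simp only [listVariation]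
  linarith

theorem listVariation_append_pair_reverse (u w : List ℝ) (a b : ℝ) :
    listVariation (w.reverse ++ b :: a :: u.reverse) = listVariation (u ++ a :: b :: w) := by
  rw [← listVariation_reverse]
  simp

theorem listVariation_lt_append_pair {u w : List ℝ} {a b m : ℝ} (ham : a ≤ m) (hmb : m < b)
    (hw : ∀ c ∈ w, c < b) : listVariation (u ++ m :: w) < listVariation (u ++ a :: b :: w) := by
  rw [listVariation_append_cons, listVariation_append_cons a, listVariation_concat,
    listVariation_concat u a]
  have hu := listVariation_cons_le u.reverse m a
  have hw := listVariation_cons_add_lt hmb hw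
  rw [abs_of_nonneg (sub_nonneg.2 ham)] at hu
  simp only [listVariation]
  rw [abs_of_pos (by linarith : 0 < b - a)]
  linarith

theorem right_le_of_listVariation_append_pair_le {u w : List ℝ} {a b m : ℝ} (hm : m ∈ uIcc a b)
    (hmL : m ≤ L) (hw : ∀ c ∈ w, c ≤ L)
    (h : listVariation (u ++ a :: b :: w) ≤ listVariation (u ++ m :: w)) : b ≤ L := by
  by_contra! hb
  have ham : a ≤ m := by
    rcases mem_uIcc.1 hm with hab | hba
    · exact hab.1
    · linarith
  exact (listVariation_lt_append_pair ham (by linarith) fun c hc => (hw c hc).trans_lt hb).not_ge h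

theorem left_le_of_listVariation_append_pair_le {u w : List ℝ} {a b m : ℝ} (hm : m ∈ uIcc a b)
    (hmL : m ≤ L) (hu : ∀ c ∈ u, c ≤ L)
    (h : listVariation (u ++ a :: b :: w) ≤ listVariation (u ++ m :: w)) : a ≤ L := by
  refine right_le_of_listVariation_append_pair_le (u := w.reverse) (w := u.reverse) (a := b)
    (uIcc_comm a b ▸ hm) hmL (fun c hc => hu c (List.mem_reverse.1 hc)) ?_
  rw [listVariation_append_pair_reverse, ← listVariation_reverse (w.reverse ++ _)]
  simpa using h

theorem slopes_append_cons_cons (a b : ℝ) (w : List ℝ) : ∀ u : List ℝ,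
    slopes f (u ++ a :: b :: w) = slopes f (u ++ [a]) ++ slope f a b :: slopes f (b :: w)
  | [] => rfl
  | [_] => rfl
  | c :: d :: u => by
    have ih := slopes_append_cons_cons a b w (d :: u)
    simp only [List.cons_append, slopes] at ih ⊢
    rw [ih]

theorem slopes_congr : ∀ {P : List ℝ}, (∀ t ∈ P, f t = g t) → slopes f P = slopes g P
  | [], _ => rfl
  | [_], _ => rfl
  | a :: b :: P, h => by
    rw [slopes, slopes, slopes_congr fun t ht => h t (List.mem_cons_of_mem a ht),
      slope_def_field, slope_def_field, h a (by simp), h b (by simp)]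

theorem slopes_neg : ∀ P : List ℝ, slopes (-f) P = (slopes f P).map (- ·)
  | [] => rfl
  | [_] => rfl
  | a :: b :: P => by
    rw [slopes, slopes, slopes_neg (b :: P), List.map_cons, slope_neg_fun,
      Pi.neg_apply, Pi.neg_apply]

theorem exists_slope_eq_of_mem_slopes : ∀ {P : List ℝ}, P.SortedLT → ∀ σ ∈ slopes f P,
    ∃ a ∈ P, ∃ b ∈ P, a < b ∧ slope f a b = σ
  | a :: b :: P, hP, σ, hσ => by
    rcases List.mem_cons.1 hσ with rfl | hσ
    · exact ⟨a, by simp, b, by simp, (List.pairwise_cons.1 hP.pairwise).1 b (by simp), rfl⟩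
    · obtain ⟨c, hc, d, hd, h⟩ :=
        exists_slope_eq_of_mem_slopes (List.pairwise_cons.1 hP.pairwise).2.sortedLT σ hσ
      exact ⟨c, List.mem_cons_of_mem a hc, d, List.mem_cons_of_mem a hd, h⟩

theorem pairwise_sub_le_of_slopes_le : ∀ {P : List ℝ}, P.SortedLT → (∀ σ ∈ slopes f P, σ ≤ L) →
    P.Pairwise fun a b => f b - f a ≤ L * (b - a)
  | [], _, _ => List.Pairwise.nil
  | [a], _, _ => List.pairwise_singleton _ a
  | a :: b :: P, hP, hL => by
    obtain ⟨haP, hbP⟩ := List.pairwise_cons.1 hP.pairwise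
    obtain ⟨hab, hσ⟩ := List.forall_mem_cons.1 hL
    have hbc := pairwise_sub_le_of_slopes_le hbP.sortedLT hσ
    rw [slope_def_field, div_le_iff₀ (sub_pos.2 (haP b List.mem_cons_self))] at hab
    refine List.pairwise_cons.2 ⟨List.forall_mem_cons.2 ⟨hab, fun c hc => ?_⟩, hbc⟩
    linarith [(List.pairwise_cons.1 hbc).1 c hc]

theorem slope_mem_uIcc_slope {a b c : ℝ} (hab : a < b) (hbc : b < c) :
    slope f a c ∈ uIcc (slope f a b) (slope f b c) := by
  have hac : 0 < c - a := by linarith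
  rw [← segment_eq_uIcc, segment_eq_image_lineMap]
  refine ⟨(c - b) / (c - a), ⟨?_, ?_⟩, lineMap_slope_slope_sub_div_sub f a b c (hab.trans hbc).ne⟩
  · exact div_nonneg (sub_nonneg.2 hbc.le) hac.le
  · exact (div_le_one hac).2 (by linarith)

theorem slopeVariation_nonneg (f : ℝ → ℝ) (P : List ℝ) : 0 ≤ slopeVariation f P :=
  listVariation_nonneg _

theorem slopeVariation_neg (f : ℝ → ℝ) : ∀ P, slopeVariation (-f) P = slopeVariation f P
  | [] => rfl
  | [_] => rfl
  | [_, _] => rfl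
  | a :: b :: c :: P => by
    have ih := slopeVariation_neg f (b :: c :: P)
    simp only [slopeVariation, slopes, listVariation, slope_neg_fun, Pi.neg_apply] at ih ⊢
    rw [ih, neg_sub_neg, abs_sub_comm]

theorem exists_eq_append_sortedLT_insert {p : ℝ} : ∀ {P : List ℝ}, P.SortedLT → p ∉ P →
    ∃ u w, P = u ++ w ∧ (u ++ p :: w).SortedLT
  | [], _, _ => ⟨[], [], rfl, (List.pairwise_singleton _ p).sortedLT⟩
  | a :: P, hP, hp => by
    obtain ⟨haP, hPP⟩ := List.pairwise_cons.1 hP.pairwise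
    rcases lt_or_gt_of_ne (List.ne_of_not_mem_cons hp) with hpa | hap
    · have hpP : ∀ b ∈ a :: P, p < b :=
        List.forall_mem_cons.2 ⟨hpa, fun b hb => hpa.trans (haP b hb)⟩
      exact ⟨[], a :: P, rfl, (List.pairwise_cons.2 ⟨hpP, hP.pairwise⟩).sortedLT⟩
    · obtain ⟨u, w, rfl, huw⟩ :=
        exists_eq_append_sortedLT_insert hPP.sortedLT (List.not_mem_of_not_mem_cons hp)
      refine ⟨a :: u, w, rfl, (List.pairwise_cons.2 ⟨fun b hb => ?_, huw.pairwise⟩).sortedLT⟩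
      rcases List.mem_cons.1 (List.perm_middle.mem_iff.1 hb) with rfl | hb
      · exact hap
      · exact haP b hb

theorem slope_mem_uIcc_of_sortedLT {u w : List ℝ} {a p b : ℝ}
    (h : (u ++ [a] ++ p :: b :: w).SortedLT) :
    slope f a b ∈ uIcc (slope f a p) (slope f p b) := by
  obtain ⟨-, hpw, hup⟩ := List.pairwise_append.1 h.pairwise
  exact slope_mem_uIcc_slope (hup a (by simp) p (by simp))
    ((List.pairwise_cons.1 hpw).1 b (by simp))

theorem slopeVariation_le_insert {u w : List ℝ} {p : ℝ} (h : (u ++ p :: w).SortedLT) :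
    slopeVariation f (u ++ w) ≤ slopeVariation f (u ++ p :: w) := by
  rcases List.eq_nil_or_concat' u with rfl | ⟨u, a, rfl⟩ <;> rcases w with - | ⟨b, w⟩
  · exact le_rfl
  · exact listVariation_le_cons _ _
  · simp only [slopeVariation, List.append_assoc, List.singleton_append, slopes_append_cons_cons,
      List.append_nil]
    exact listVariation_le_concat _ _
  · simp only [slopeVariation, List.append_assoc, List.singleton_append, slopes_append_cons_cons]
    exact listVariation_le_append_pair _ _ (slope_mem_uIcc_of_sortedLT h)

theorem slopes_ne_nil {P : List ℝ} (h : 2 ≤ P.length) : slopes f P ≠ [] := by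
  match P, h with
  | _ :: _ :: _, _ => exact List.cons_ne_nil _ _

theorem slopes_le_of_slopeVariation_insert_le {u w : List ℝ} {p : ℝ}
    (h : (u ++ p :: w).SortedLT) (hlen : 2 ≤ (u ++ w).length) (hL : ∀ σ ∈ slopes f (u ++ w), σ ≤ L)
    (hV : slopeVariation f (u ++ p :: w) ≤ slopeVariation f (u ++ w)) :
    ∀ σ ∈ slopes f (u ++ p :: w), σ ≤ L := by
  have hne := slopes_ne_nil (f := f) hlen
  rcases List.eq_nil_or_concat' u with rfl | ⟨u, a, rfl⟩ <;> rcases w with - | ⟨b, w⟩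
  · simp at hlen
  · exact List.forall_mem_cons.2 ⟨hL _ (mem_of_listVariation_cons_le hne hV), hL⟩
  · simp only [slopeVariation, List.append_assoc, List.singleton_append, slopes_append_cons_cons,
      List.append_nil] at hL hne hV ⊢
    exact List.forall_mem_append.2 ⟨hL, List.forall_mem_cons.2
      ⟨hL _ (mem_of_listVariation_concat_le hne hV), List.forall_mem_nil _⟩⟩
  · have hm := slope_mem_uIcc_of_sortedLT (f := f) h
    simp only [slopeVariation, List.append_assoc, List.singleton_append,
      slopes_append_cons_cons, List.forall_mem_append, List.forall_mem_cons] at hL hV ⊢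
    obtain ⟨hu, hab, hw⟩ := hL
    exact ⟨hu, left_le_of_listVariation_append_pair_le hm hab hu hV, List.forall_mem_cons.2
      ⟨right_le_of_listVariation_append_pair_le hm hab hw hV, hw⟩⟩

end Slopes

section LowerBound

open scoped Convolution
open ContinuousLinearMap (lsmul)

variable {f ρ : ℝ → ℝ} {a b c : ℝ}

/-- The continuous function that is `0` on `(-∞, a]`, affine on `[a, b]` and `1` on `[b, ∞)`. -/
noncomputable def ramp (a b x : ℝ) : ℝ :=
  (max (x - a) 0 - max (x - b) 0) / (b - a)

/-- The hat function that is affine on `[a, b]` and `[b, c]`, takes the value `1` at `b` and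
vanishes outside `[a, c]`. -/
noncomputable def hat (a b c x : ℝ) : ℝ :=
  ramp a b x - ramp b c x

theorem continuous_hat (a b c : ℝ) : Continuous (hat a b c) := by
  unfold hat ramp
  fun_prop

theorem ramp_of_le (hab : a ≤ b) {x : ℝ} (hx : x ≤ a) : ramp a b x = 0 := by
  rw [ramp, max_eq_right (by linarith), max_eq_right (by linarith), sub_zero, zero_div]

theorem ramp_of_ge (hab : a < b) {x : ℝ} (hx : b ≤ x) : ramp a b x = 1 := by
  rw [ramp, max_eq_left (by linarith), max_eq_left (by linarith), sub_sub_sub_cancel_left,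
    div_self (sub_pos.2 hab).ne']

theorem ramp_nonneg (hab : a ≤ b) (x : ℝ) : 0 ≤ ramp a b x :=
  div_nonneg (sub_nonneg.2 (max_le_max_right 0 (by linarith))) (sub_nonneg.2 hab)

theorem ramp_le_one (hab : a < b) (x : ℝ) : ramp a b x ≤ 1 := by
  rw [ramp, div_le_one (sub_pos.2 hab), sub_le_iff_le_add]
  exact max_le (by linarith [le_max_left (x - b) 0]) (by linarith [le_max_right (x - b) 0])

theorem hat_nonneg (hab : a < b) (hbc : b < c) (x : ℝ) : 0 ≤ hat a b c x := by
  refine sub_nonneg.2 ?_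
  rcases le_total x b with hx | hx
  · exact (ramp_of_le hbc.le hx).trans_le (ramp_nonneg hab.le x)
  · exact (ramp_le_one hbc x).trans_eq (ramp_of_ge hab hx).symm

theorem hasCompactSupport_hat (hab : a < b) (hbc : b < c) : HasCompactSupport (hat a b c) := by
  refine HasCompactSupport.of_support_subset_isCompact (isCompact_Icc (a := a) (b := c))
    fun x hx => ?_
  by_contra hxac
  refine hx ?_
  rcases not_and_or.1 hxac with h | h <;> rw [not_le] at h
  · rw [hat, ramp_of_le hab.le h.le, ramp_of_le hbc.le (by linarith), sub_self]
  · rw [hat, ramp_of_ge hab (by linarith), ramp_of_ge hbc h.le, sub_self]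

theorem deriv_deriv_convolution (hρ : ContDiff ℝ ∞ ρ) (hc : HasCompactSupport ρ) {g : ℝ → ℝ}
    (hg : Continuous g) :
    deriv (deriv (ρ ⋆[lsmul ℝ ℝ, volume] g)) = deriv (deriv ρ) ⋆[lsmul ℝ ℝ, volume] g := by
  have hderiv : ∀ {η : ℝ → ℝ}, ContDiff ℝ ∞ η → HasCompactSupport η →
      deriv (η ⋆[lsmul ℝ ℝ, volume] g) = deriv η ⋆[lsmul ℝ ℝ, volume] g := fun hη hcη =>
    funext fun x => (hcη.hasDerivAt_convolution_left _ (hη.of_le (by simp))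
      hg.locallyIntegrable x).deriv
  rw [hderiv hρ hc, hderiv (contDiff_infty_iff_deriv.1 hρ).2 hc.deriv]

theorem integral_slope_sub_slope {G : ℝ → ℝ → ℝ} (hG : ∀ d, Integrable (G d)) (a b c : ℝ) :
    ∫ t, ((G a t - G b t) / (b - a) - (G b t - G c t) / (c - b)) =
      ((∫ t, G a t) - ∫ t, G b t) / (b - a) - ((∫ t, G b t) - ∫ t, G c t) / (c - b) := by
  have hsub : ∀ d e w, Integrable fun t => (G d t - G e t) / w := fun d e w =>
    ((hG d).sub (hG e)).div_const w
  rw [integral_sub (hsub a b _) (hsub b c _), integral_div, integral_div,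
    integral_sub (hG a) (hG b), integral_sub (hG b) (hG c)]

theorem convolution_deriv_deriv_hat (hρ : ContDiff ℝ ∞ ρ) (hc : HasCompactSupport ρ)
    (a b c x : ℝ) :
    (deriv (deriv ρ) ⋆[lsmul ℝ ℝ, volume] hat a b c) x =
      (ρ (x - a) - ρ (x - b)) / (b - a) - (ρ (x - b) - ρ (x - c)) / (c - b) := by
  have hint : ∀ d, Integrable fun t => max (x - d - t) 0 * deriv (deriv ρ) t := fun d =>
    integrable_mul_deriv_deriv (by fun_prop) hρ hc
  simp only [← integral_hinge_mul_deriv_deriv hρ hc]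
  rw [convolution_def, ← integral_slope_sub_slope hint]
  refine integral_congr_ae (Eventually.of_forall fun t => ?_)
  simp only [hat, ramp, ContinuousLinearMap.lsmul_apply, smul_eq_mul, sub_right_comm x t]
  ring

theorem integral_mul_comp_sub_eq_convolution (hρ : Function.Even ρ) (a : ℝ) :
    ∫ x, f x * ρ (x - a) = (ρ ⋆[lsmul ℝ ℝ, volume] f) a := by
  rw [convolution_eq_swap]
  refine integral_congr_ae (Eventually.of_forall fun x => ?_)
  simp only [ContinuousLinearMap.lsmul_apply, smul_eq_mul]
  rw [← hρ (a - x), neg_sub, mul_comm]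

theorem integral_mul_convolution_deriv_deriv_hat (hf : Continuous f) (hρ : ContDiff ℝ ∞ ρ)
    (hc : HasCompactSupport ρ) (heven : Function.Even ρ) (a b c : ℝ) :
    ∫ x, f x * (deriv (deriv ρ) ⋆[lsmul ℝ ℝ, volume] hat a b c) x =
      slope (ρ ⋆[lsmul ℝ ℝ, volume] f) b c - slope (ρ ⋆[lsmul ℝ ℝ, volume] f) a b := by
  have hint : ∀ d, Integrable fun x => f x * ρ (x - d) := fun d =>
    (hf.mul (hρ.continuous.comp (by fun_prop))).integrable_of_hasCompactSupport
      (hc.comp_homeomorph (Homeomorph.subRight d)).mul_left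
  have hexp : ∀ x, f x * (deriv (deriv ρ) ⋆[lsmul ℝ ℝ, volume] hat a b c) x =
      (f x * ρ (x - a) - f x * ρ (x - b)) / (b - a) -
        (f x * ρ (x - b) - f x * ρ (x - c)) / (c - b) := fun x => by
    rw [convolution_deriv_deriv_hat hρ hc]
    ring
  simp only [hexp]
  rw [integral_slope_sub_slope hint]
  simp only [integral_mul_comp_sub_eq_convolution heven, slope_def_field]
  ring

theorem integrable_mul_convolution {η ψ : ℝ → ℝ} (hf : Continuous f) (hη : Continuous η)
    (hcη : HasCompactSupport η) (hψ : Continuous ψ) (hcψ : HasCompactSupport ψ) :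
    Integrable fun x => f x * (η ⋆[lsmul ℝ ℝ, volume] ψ) x := by
  have hcont : Continuous (η ⋆[lsmul ℝ ℝ, volume] ψ) :=
    hcη.continuous_convolution_left _ hη hψ.locallyIntegrable
  have hsupp : HasCompactSupport (η ⋆[lsmul ℝ ℝ, volume] ψ) := hcη.convolution _ hcψ
  exact (hf.mul hcont).integrable_of_hasCompactSupport hsupp.mul_left

theorem integral_mul_convolution_smul_add {η ψ χ : ℝ → ℝ} (hf : Continuous f) (hη : Continuous η)
    (hcη : HasCompactSupport η) (hψ : Continuous ψ) (hcψ : HasCompactSupport ψ)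
    (hχ : Continuous χ) (hcχ : HasCompactSupport χ) (ε : ℝ) :
    ∫ x, f x * (η ⋆[lsmul ℝ ℝ, volume] (ε • ψ + χ)) x =
      ε * (∫ x, f x * (η ⋆[lsmul ℝ ℝ, volume] ψ) x) +
        ∫ x, f x * (η ⋆[lsmul ℝ ℝ, volume] χ) x := by
  have hexists : ∀ {g : ℝ → ℝ}, Continuous g → ConvolutionExists η g (lsmul ℝ ℝ) volume :=
    fun hg => hcη.convolutionExists_left _ hη hg.locallyIntegrable
  have hexp : ∀ x, f x * (η ⋆[lsmul ℝ ℝ, volume] (ε • ψ + χ)) x =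
      ε * (f x * (η ⋆[lsmul ℝ ℝ, volume] ψ) x) + f x * (η ⋆[lsmul ℝ ℝ, volume] χ) x := fun x => by
    rw [(hexists (hψ.const_smul ε)).distrib_add (hexists hχ), convolution_smul,
      Pi.add_apply, Pi.smul_apply, smul_eq_mul]
    ring
  simp only [hexp]
  rw [integral_add ((integrable_mul_convolution hf hη hcη hψ hcψ).const_mul ε)
    (integrable_mul_convolution hf hη hcη hχ hcχ), integral_const_mul]

theorem exists_abs_le_one_mul_eq_abs (s : ℝ) : ∃ ε : ℝ, |ε| ≤ 1 ∧ ε * s = |s| := by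
  rcases abs_choice s with h | h
  · exact ⟨1, abs_one.le, by rw [h, one_mul]⟩
  · exact ⟨-1, by rw [abs_neg, abs_one], by rw [h, neg_one_mul]⟩

theorem exists_integral_eq_slopeVariation (hf : Continuous f) (hρ : ContDiff ℝ ∞ ρ)
    (hc : HasCompactSupport ρ) (heven : Function.Even ρ) : ∀ (a b : ℝ) (P : List ℝ),
    (a :: b :: P).SortedLT → ∃ ψ : ℝ → ℝ, Continuous ψ ∧ HasCompactSupport ψ ∧
      (∀ x, |ψ x| ≤ ramp a b x) ∧
      ∫ x, f x * (deriv (deriv ρ) ⋆[lsmul ℝ ℝ, volume] ψ) x =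
        slopeVariation (ρ ⋆[lsmul ℝ ℝ, volume] f) (a :: b :: P)
  | a, b, [], hP => by
    refine ⟨0, continuous_zero, .zero, fun x => ?_, ?_⟩
    · simpa using ramp_nonneg ((List.pairwise_cons.1 hP.pairwise).1 b (by simp)).le x
    · simp [convolution_zero, slopeVariation, slopes, listVariation]
  | a, b, c :: P, hP => by
    have hab : a < b := (List.pairwise_cons.1 hP.pairwise).1 b (by simp)
    have hbP := (List.pairwise_cons.1 hP.pairwise).2
    have hbc : b < c := (List.pairwise_cons.1 hbP).1 c (by simp)
    obtain ⟨ψ, hψ, hcψ, hψ_le, hψ_int⟩ :=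
      exists_integral_eq_slopeVariation hf hρ hc heven b c P hbP.sortedLT
    obtain ⟨ε, hε, hε_mul⟩ := exists_abs_le_one_mul_eq_abs
      (slope (ρ ⋆[lsmul ℝ ℝ, volume] f) b c - slope (ρ ⋆[lsmul ℝ ℝ, volume] f) a b)
    have hhat := continuous_hat a b c
    have hchat := hasCompactSupport_hat hab hbc
    have hρ'' : Continuous (deriv (deriv ρ)) :=
      (contDiff_infty_iff_deriv.1 (contDiff_infty_iff_deriv.1 hρ).2).2.continuous
    refine ⟨ε • hat a b c + ψ, (hhat.const_smul ε).add hψ, hchat.smul_left.add hcψ,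
      fun x => ?_, ?_⟩
    · calc |ε * hat a b c x + ψ x| ≤ |ε * hat a b c x| + |ψ x| := abs_add_le _ _
        _ ≤ hat a b c x + ramp b c x := by
          refine add_le_add ?_ (hψ_le x)
          rw [abs_mul, abs_of_nonneg (hat_nonneg hab hbc x)]
          exact mul_le_of_le_one_left (hat_nonneg hab hbc x) hε
        _ = ramp a b x := sub_add_cancel _ _
    · rw [integral_mul_convolution_smul_add hf hρ'' hc.deriv.deriv hhat hchat hψ hcψ,
        integral_mul_convolution_deriv_deriv_hat hf hρ hc heven, hψ_int, hε_mul]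
      rfl

theorem ofReal_slopeVariation_convolution_le_TV2 (hf : Continuous f) (φ : ContDiffBump (0 : ℝ)) :
    ∀ {P : List ℝ}, P.SortedLT →
      ENNReal.ofReal (slopeVariation (φ.normed volume ⋆[lsmul ℝ ℝ, volume] f) P) ≤ TV2 f
  | [], _ | [_], _ => by simp [slopeVariation, slopes, listVariation]
  | a :: b :: P, hP => by
    have hab : a < b := (List.pairwise_cons.1 hP.pairwise).1 b (by simp)
    have hρ : ContDiff ℝ ∞ (φ.normed volume) := φ.contDiff_normed
    have hc : HasCompactSupport (φ.normed volume) := φ.hasCompactSupport_normed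
    obtain ⟨ψ, hψ, hcψ, hψ_le, hψ_int⟩ :=
      exists_integral_eq_slopeVariation hf hρ hc φ.normed_neg a b P hP
    have hbound : ∀ x, |(φ.normed volume ⋆[lsmul ℝ ℝ, volume] ψ) x| ≤ 1 := fun x => by
      have hnorm : ∀ t, ‖lsmul ℝ ℝ (φ.normed volume t) (ψ (x - t))‖ ≤ φ.normed volume t :=
        fun t => by
          rw [ContinuousLinearMap.lsmul_apply, norm_smul, Real.norm_of_nonneg (φ.nonneg_normed t)]
          exact mul_le_of_le_one_right (φ.nonneg_normed t)
            ((hψ_le _).trans (ramp_le_one hab _))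
      exact (norm_integral_le_of_norm_le φ.integrable_normed
        (Eventually.of_forall hnorm)).trans_eq φ.integral_normed
    rw [← hψ_int, ← deriv_deriv_convolution hρ hc hψ]
    exact ofReal_integral_mul_deriv_deriv_le_TV2
      (hc.contDiff_convolution_left _ hρ hψ.locallyIntegrable) (hc.convolution _ hcψ) hbound f

theorem tendsto_slopeVariation {ι : Type*} {l : Filter ι} {F : ι → ℝ → ℝ}
    (hF : ∀ t, Tendsto (fun i => F i t) l (𝓝 (f t))) :
    ∀ P, Tendsto (fun i => slopeVariation (F i) P) l (𝓝 (slopeVariation f P))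
  | [] | [_] | [_, _] => tendsto_const_nhds
  | a :: b :: c :: P => by
    have hslope : ∀ s t, Tendsto (fun i => slope (F i) s t) l (𝓝 (slope f s t)) := fun s t => by
      simpa only [slope_def_field] using ((hF t).sub (hF s)).div_const (t - s)
    exact ((hslope b c).sub (hslope a b)).abs.add (tendsto_slopeVariation hF (b :: c :: P))

theorem ofReal_slopeVariation_le_TV2 (hf : Continuous f) {P : List ℝ} (hP : P.SortedLT) :
    ENNReal.ofReal (slopeVariation f P) ≤ TV2 f := by
  let φ : ℕ → ContDiffBump (0 : ℝ) := fun k =>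
    ⟨1 / ((k : ℝ) + 1), 2 / ((k : ℝ) + 1), by positivity, by gcongr; norm_num⟩
  have hφ : Tendsto (fun k => (φ k).rOut) atTop (𝓝 0) :=
    tendsto_const_div_atTop_nhds_zero_nat 2 |>.comp (tendsto_add_atTop_nat 1) |>.congr
      fun k => by simp [φ]
  exact le_of_tendsto' (ENNReal.tendsto_ofReal <| tendsto_slopeVariation
    (fun t => ContDiffBump.convolution_tendsto_right_of_continuous hφ hf t) P)
    fun k => ofReal_slopeVariation_convolution_le_TV2 hf (φ k) hP

end LowerBound

section LinearSpline

variable {f g : ℝ → ℝ} {L : ℝ} {P : List ℝ}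

theorem isCPWL_affine (α β : ℝ) : IsCPWL fun t => α + β * t :=
  ⟨by fun_prop, ∅, fun _ _ _ => ⟨β, α, fun _ _ => add_comm _ _⟩⟩

theorem isCPWL_const_mul_hinge (w a : ℝ) : IsCPWL fun t => w * max (a - t) 0 := by
  refine ⟨by fun_prop, {a}, fun I hI hd => ?_⟩
  have ha : a ∉ I := fun h => (disjoint_left.1 hd h) (by simp)
  by_cases h : ∃ t ∈ I, t < a
  · obtain ⟨t, ht, hta⟩ := h
    have hIa : ∀ u ∈ I, u ≤ a := fun u hu => by
      by_contra! hau
      exact ha (hI.out ht hu ⟨hta.le, hau.le⟩)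
    refine ⟨-w, w * a, fun u hu => ?_⟩
    beta_reduce
    rw [max_eq_left (sub_nonneg.2 (hIa u hu))]
    ring
  · push Not at h
    refine ⟨0, 0, fun u hu => ?_⟩
    beta_reduce
    rw [max_eq_right (sub_nonpos.2 (h u hu))]
    ring

theorem IsCPWL.add (hf : IsCPWL f) (hg : IsCPWL g) : IsCPWL fun t => f t + g t := by
  classical
  obtain ⟨hfc, S, hS⟩ := hf
  obtain ⟨hgc, T, hT⟩ := hg
  refine ⟨hfc.add hgc, S ∪ T, fun I hI hd => ?_⟩
  rw [Finset.coe_union, disjoint_union_right] at hd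
  obtain ⟨a, b, hab⟩ := hS I hI hd.1
  obtain ⟨c, d, hcd⟩ := hT I hI hd.2
  refine ⟨a + c, b + d, fun t ht => ?_⟩
  beta_reduce
  rw [hab t ht, hcd t ht]
  ring

/-- The continuous function that interpolates `f` at the points of an increasing list, is affine
between consecutive points, and is extended affinely beyond the first and last points. It is
built from right to left, each knot contributing a hinge supported on its left. -/
noncomputable def linearSpline (f : ℝ → ℝ) : List ℝ → ℝ → ℝ
  | a :: b :: c :: P => fun t =>
      linearSpline f (b :: c :: P) t + (slope f b c - slope f a b) * max (b - t) 0
  | [a, b] => fun t => f a - slope f a b * a + slope f a b * t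
  | [a] => fun _ => f a
  | [] => 0

theorem isCPWL_linearSpline (f : ℝ → ℝ) : ∀ P, IsCPWL (linearSpline f P)
  | [] => by simpa [Pi.zero_def, linearSpline] using isCPWL_affine 0 0
  | [a] => by simpa [linearSpline] using isCPWL_affine (f a) 0
  | [_, _] => isCPWL_affine _ _
  | _ :: b :: c :: P => (isCPWL_linearSpline f (b :: c :: P)).add (isCPWL_const_mul_hinge _ b)

theorem TV2_linearSpline_le (f : ℝ → ℝ) :
    ∀ P, TV2 (linearSpline f P) ≤ ENNReal.ofReal (slopeVariation f P)
  | [] => by simpa [Pi.zero_def, linearSpline] using (TV2_affine 0 0).trans_le zero_le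
  | [a] => by simpa [linearSpline] using (TV2_affine (f a) 0).trans_le zero_le
  | [_, _] => (TV2_affine _ _).trans_le zero_le
  | a :: b :: c :: P => by
    have hV : slopeVariation f (a :: b :: c :: P) =
        slopeVariation f (b :: c :: P) + |slope f b c - slope f a b| := add_comm _ _
    rw [hV, ENNReal.ofReal_add (slopeVariation_nonneg f _) (abs_nonneg _)]
    exact (TV2_add_le (isCPWL_linearSpline f _).1 (by fun_prop)).trans
      (add_le_add (TV2_linearSpline_le f (b :: c :: P)) (TV2_const_mul_hinge_le _ b))

theorem linearSpline_of_le_second {a b t : ℝ} : ∀ {P : List ℝ}, (a :: b :: P).SortedLT → t ≤ b →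
    linearSpline f (a :: b :: P) t = f a - slope f a b * a + slope f a b * t
  | [], _, _ => rfl
  | c :: P, hP, ht => by
    have hbP := (List.pairwise_cons.1 hP.pairwise).2
    have hbc : b < c := (List.pairwise_cons.1 hbP).1 c List.mem_cons_self
    have hfb : (b - a) * slope f a b = f b - f a := sub_smul_slope f a b
    simp only [linearSpline]
    rw [linearSpline_of_le_second hbP.sortedLT (ht.trans hbc.le), max_eq_left (sub_nonneg.2 ht)]
    linarith

theorem linearSpline_eq_of_mem : ∀ {P : List ℝ}, P.SortedLT → ∀ t ∈ P, linearSpline f P t = f t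
  | [_], _, _, ht => by rw [List.mem_singleton.1 ht, linearSpline]
  | a :: b :: P, hP, t, ht => by
    obtain ⟨haP, hbP⟩ := List.pairwise_cons.1 hP.pairwise
    have hfb : (b - a) * slope f a b = f b - f a := sub_smul_slope f a b
    rcases List.mem_cons.1 ht with rfl | ht
    · rw [linearSpline_of_le_second hP (haP b List.mem_cons_self).le]
      ring
    rcases List.mem_cons.1 ht with rfl | htP
    · rw [linearSpline_of_le_second hP le_rfl]
      linarith
    · have hbt : b < t := (List.pairwise_cons.1 hbP).1 t htP
      obtain ⟨c, Q, rfl⟩ := List.exists_cons_of_ne_nil (List.ne_nil_of_mem htP)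
      simp only [linearSpline]
      rw [linearSpline_eq_of_mem hbP.sortedLT t ht, max_eq_right (sub_nonpos.2 hbt.le), mul_zero,
        add_zero]

end LinearSpline

section LipschitzBound

variable {f : ℝ → ℝ} {L : ℝ} {P : List ℝ}

/-- The invariant of the proof that `f` inherits the slope bound `L` of its samples: `P` consists
of at least two increasing points, the slopes of `f` along `P` are at most `L`, and they account
for all of the second-order total variation of `f`. -/
structure IsTightSampling (f : ℝ → ℝ) (L : ℝ) (P : List ℝ) : Prop where
  sortedLT : P.SortedLT
  two_le_length : 2 ≤ P.length
  slopes_le : ∀ σ ∈ slopes f P, σ ≤ L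
  TV2_le : TV2 f ≤ ENNReal.ofReal (slopeVariation f P)

theorem IsTightSampling.exists_insert (h : IsTightSampling f L P) (hf : Continuous f) (p : ℝ) :
    ∃ Q, IsTightSampling f L Q ∧ p ∈ Q ∧ P ⊆ Q := by
  by_cases hp : p ∈ P
  · exact ⟨P, h, hp, List.Subset.refl P⟩
  obtain ⟨u, w, rfl, huw⟩ := exists_eq_append_sortedLT_insert h.sortedLT hp
  have hlen : (u ++ p :: w).length = (u ++ w).length + 1 := List.perm_middle.length_eq
  have hV : slopeVariation f (u ++ p :: w) ≤ slopeVariation f (u ++ w) :=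
    (ENNReal.ofReal_le_ofReal_iff (slopeVariation_nonneg f _)).1
      ((ofReal_slopeVariation_le_TV2 hf huw).trans h.TV2_le)
  refine ⟨u ++ p :: w, ⟨huw, ?_, ?_, ?_⟩, by simp, ?_⟩
  · exact hlen ▸ h.two_le_length.trans (Nat.le_succ _)
  · exact slopes_le_of_slopeVariation_insert_le huw h.two_le_length h.slopes_le hV
  · exact h.TV2_le.trans (ENNReal.ofReal_le_ofReal (slopeVariation_le_insert huw))
  · exact fun a ha => List.perm_middle.mem_iff.2 (List.mem_cons_of_mem p ha)

theorem IsTightSampling.sub_le (h : IsTightSampling f L P) (hf : Continuous f) {s t : ℝ}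
    (hst : s < t) : f t - f s ≤ L * (t - s) := by
  obtain ⟨Q, hQ, hsQ, -⟩ := h.exists_insert hf s
  obtain ⟨R, hR, htR, hQR⟩ := hQ.exists_insert hf t
  have hslope := pairwise_sub_le_of_slopes_le hR.sortedLT hR.slopes_le
  obtain ⟨i, hi, rfl⟩ := List.getElem_of_mem (hQR hsQ)
  obtain ⟨j, hj, rfl⟩ := List.getElem_of_mem htR
  exact List.pairwise_iff_getElem.1 hslope i j hi hj (hR.sortedLT.getElem_lt_getElem_iff.1 hst)

theorem abs_sub_le_of_TV2_le_slopeVariation (hf : Continuous f) (hP : P.SortedLT)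
    (hlen : 2 ≤ P.length) (hTV : TV2 f ≤ ENNReal.ofReal (slopeVariation f P))
    (hL : ∀ a ∈ P, ∀ b ∈ P, |f a - f b| ≤ L * |a - b|) (s t : ℝ) :
    |f s - f t| ≤ L * |s - t| := by
  have hslope : ∀ σ ∈ slopes f P, |σ| ≤ L := fun σ hσ => by
    obtain ⟨a, ha, b, hb, hab, rfl⟩ := exists_slope_eq_of_mem_slopes hP σ hσ
    rw [slope_def_field, abs_div]
    exact (div_le_iff₀ (abs_pos.2 (sub_ne_zero.2 hab.ne'))).2 (hL b hb a ha)
  have hpos : IsTightSampling f L P :=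
    ⟨hP, hlen, fun σ hσ => (abs_le.1 (hslope σ hσ)).2, hTV⟩
  have hneg : IsTightSampling (-f) L P := by
    refine ⟨hP, hlen, fun σ hσ => ?_, by rwa [TV2_neg, slopeVariation_neg]⟩
    rw [slopes_neg] at hσ
    obtain ⟨τ, hτ, rfl⟩ := List.mem_map.1 hσ
    exact neg_le.1 (abs_le.1 (hslope τ hτ)).1
  wlog hst : s < t generalizing s t with H
  · rcases (not_lt.1 hst).eq_or_lt with rfl | hts
    · simp
    · rw [abs_sub_comm, abs_sub_comm s]
      exact H t s hts
  rw [abs_sub_comm, abs_sub_comm s, abs_of_pos (sub_pos.2 hst), abs_le]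
  have h₁ := hneg.sub_le hf.neg hst
  rw [Pi.neg_apply, Pi.neg_apply] at h₁
  exact ⟨by linarith, hpos.sub_le hf hst⟩

end LipschitzBound

section SplineInterpolation

variable {n : ℕ} {x z : Fin (n + 1) → ℝ} {f g : ℝ → ℝ}

theorem TV2_linearSpline_le_of_interpolates (hx : StrictMono x) (hf : Continuous f)
    (hfi : Interpolates x z f) (hgi : Interpolates x z g) :
    TV2 (linearSpline g (List.ofFn x)) ≤ TV2 f := by
  have hgf : slopes g (List.ofFn x) = slopes f (List.ofFn x) :=
    slopes_congr (List.forall_mem_ofFn_iff.2 fun m => (hgi m).trans (hfi m).symm)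
  refine (TV2_linearSpline_le g _).trans ?_
  rw [slopeVariation, hgf]
  exact ofReal_slopeVariation_le_TV2 hf hx.sortedLT_ofFn

theorem linearSpline_mem_tv2InterpSolutions (hx : StrictMono x) (hgi : Interpolates x z g) :
    linearSpline g (List.ofFn x) ∈ tv2InterpSolutions x z :=
  ⟨⟨(isCPWL_linearSpline g _).1, (TV2_linearSpline_le g _).trans_lt ENNReal.ofReal_lt_top⟩,
    fun m => (linearSpline_eq_of_mem hx.sortedLT_ofFn _ (List.mem_ofFn.2 ⟨m, rfl⟩)).trans (hgi m),
    fun _ hf hfi => TV2_linearSpline_le_of_interpolates hx hf.1 hfi hgi⟩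

theorem abs_sub_le_of_mem_tv2InterpSolutions (hn : 1 ≤ n) (hx : StrictMono x)
    (hf : f ∈ tv2InterpSolutions x z) (s t : ℝ) : |f s - f t| ≤ maxSlope x z * |s - t| := by
  obtain ⟨hfBV, hfi, hmin⟩ := hf
  obtain ⟨hsBV, hsi, -⟩ := linearSpline_mem_tv2InterpSolutions hx hfi
  refine abs_sub_le_of_TV2_le_slopeVariation hfBV.1 hx.sortedLT_ofFn (by simpa using hn)
    ((hmin _ hsBV hsi).trans (TV2_linearSpline_le f _)) ?_ s t
  simp only [List.forall_mem_ofFn_iff, hfi _]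
  exact abs_sub_le_maxSlope_mul hx z

theorem exists_isCPWL_mem_tv2InterpSolutions (hx : StrictMono x) (z : Fin (n + 1) → ℝ) :
    ∃ f ∈ lipInterpSolutions x z, IsCPWL f ∧ (f : ℝ → ℝ) ∈ tv2InterpSolutions x z := by
  obtain ⟨g, hg⟩ := nonempty_lipInterpSolutions hx z
  have hspline := linearSpline_mem_tv2InterpSolutions hx hg.1
  have hLip : ∀ s t, |linearSpline g (List.ofFn x) s - linearSpline g (List.ofFn x) t| ≤
      maxSlope x z * |s - t| := by
    rcases n.eq_zero_or_pos with rfl | hn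
    · intro s t
      simpa [linearSpline] using mul_nonneg (maxSlope_nonneg x z) (abs_nonneg (s - t))
    · exact abs_sub_le_of_mem_tv2InterpSolutions hn hx hspline
  obtain ⟨hL, hV⟩ := exists_mem_lipInterpSolutions hx hLip hspline.2.1
  exact ⟨_, hV, isCPWL_linearSpline g _, hspline⟩

end SplineInterpolation

theorem theorem2 {n : ℕ} (E : ℝ → ℝ → ℝ)
    (hE_convex : ∀ v, StrictConvexOn ℝ univ (fun u => E u v))
    (hE_coercive : ∀ v, Tendsto (fun u => E u v) (cocompact ℝ) atTop)
    (lam : ℝ) (hlam : 0 < lam)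
    (x y : Fin (n + 1) → ℝ) (hx : StrictMono x) :
    -- the solution set is nonempty, convex and weak*-compact
    ((lipSolutions E lam x y).Nonempty ∧ Convex ℝ (lipSolutions E lam x y) ∧
      IsWeakStarCompact (lipSolutions E lam x y)) ∧
    -- reduction to an interpolation problem, with a unique vector of values
    (∃! z : Fin (n + 1) → ℝ, lipSolutions E lam x y = lipInterpSolutions x z) ∧
    ∀ z : Fin (n + 1) → ℝ, lipSolutions E lam x y = lipInterpSolutions x z →
      -- the optimal Lipschitz constant
      ((∀ f ∈ lipSolutions E lam x y, lipConst f = maxSlope x z) ∧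
        ∀ f : ℝ → ℝ, (∀ s t, |f s - f t| ≤ maxSlope x z * |s - t|) → Interpolates x z f →
          ∃ hf : f ∈ LipR, (⟨f, hf⟩ : LipR) ∈ lipSolutions E lam x y) ∧
      -- the union of the graphs of the solutions
      unionGraph (lipSolutions E lam x y) =
        (⋃ m ∈ Finset.Icc 1 (n + 1 + 1),
          rightConeAt x z (maxSlope x z) (m - 1) ∩ leftConeAt x z (maxSlope x z) m) ∧
      -- minimal second-order total-variation interpolants (of at least two points) are solutions
      (1 ≤ n → ∀ f ∈ tv2InterpSolutions x z,
        ∃ hf : f ∈ LipR, (⟨f, hf⟩ : LipR) ∈ lipSolutions E lam x y) ∧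
      -- there is a continuous and piecewise-linear solution, which is such an interpolant
      ∃ f ∈ lipSolutions E lam x y, IsCPWL f ∧ (f : ℝ → ℝ) ∈ tv2InterpSolutions x z := by
  obtain ⟨z₀, hz₀⟩ := exists_isMinOn_valueCost hE_convex hE_coercive hlam.le x y
  have heq := lipSolutions_eq_lipInterpSolutions hE_convex hlam hx hz₀
  refine ⟨?_, ⟨z₀, heq, fun z hz => ?_⟩, fun z hz => ?_⟩
  · rw [heq]
    exact ⟨nonempty_lipInterpSolutions hx z₀, convex_lipInterpSolutions hx z₀,
      isWeakStarCompact_lipInterpSolutions hx z₀⟩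
  · obtain ⟨f, hf⟩ := nonempty_lipInterpSolutions hx z
    have hf₀ : f ∈ lipInterpSolutions x z₀ := by rwa [← heq, hz]
    exact funext fun m => (hf.1 m).symm.trans (hf₀.1 m)
  · rw [hz]
    exact ⟨⟨fun f hf => lipConst_eq_maxSlope hx hf,
        fun f hf hfi => exists_mem_lipInterpSolutions hx hf hfi⟩,
      unionGraph_lipInterpSolutions hx z,
      fun hn f hf => exists_mem_lipInterpSolutions hx
        (abs_sub_le_of_mem_tv2InterpSolutions hn hx hf) hf.2.1,
      exists_isCPWL_mem_tv2InterpSolutions hx z⟩
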